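/- **Setting.** All manifolds are real, modelled on Banach spaces, and smooth. A pair $(M,h_M)$ consists of a manifold $M$ and a $C^\infty$ function $h_M:M\to\mathbb R$ having $0$ as a regular value. For maps $f_1,f_2$ from $M$ to a manifold $P$ and an integer $r\ge1$, write $f_2=f_1+O(h_M^r)$ if $f_1=f_2$ on $h_M^{-1}(0)$ and, for every $m_0\in h_M^{-1}(0)$, there are a chart $\nu$ of $P$ at $f_1(m_0)=f_2(m_0)$ and a function $\delta$ defined near $m_0$ and continuous at $m_0$ such that $\nu(f_2(m))-\nu(f_1(m))=h_M(m)^r\,\delta(m)$ for all $m$ near $m_0$. For maps defined on an open set $W$ this is required at the points of $W\cap h_M^{-1}(0)$. Let $k\ge 1$. A $C^k$ *skew critical problem* $(\alpha,\mathcal D,g)$ consists of a $C^k$ one-form $\alpha$ on $M$, a $C^k$ distribution (subbundle of $TM$, with typical fiber $\mathbb D$, a closed complemented subspace of the model space) $\mathcal D$ on $M$, and a $C^k$ submersion $g:M\to N$ (i.e. $Tg$ is surjective with split kernel). A point $m$ is a *skew critical point at $n$* if $\alpha(m)|_{\mathcal D_m}=0$ and $g(m)=n$. It is *nondegenerate*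 if the map $\ker T_mg\to\mathcal D_m^*$, $u\mapsto\bigl(v\mapsto\langle d(i_V\alpha)(m),u\rangle\bigr)$, where $V$ is any local $C^1$ vector field with values in $\mathcal D$ and $V(m)=v$, is a linear isomorphism (of Banach spaces). Let $N$ be paracompact, let $M_0\subseteq M$ and $N_0\subseteq N$ be closed $C^k$ submanifolds. A *semiglobal solution* of $(\alpha,\mathcal D,g)$ along $M_0,N_0$ is a $C^k$ map $\gamma:V\to U$ between open neighborhoods $V\supseteq N_0$ and $U\supseteq M_0$ that restricts to a $C^k$ diffeomorphism $N_0\to M_0$, such that $\gamma(n)$ is a nondegenerate skew critical point at $n$ for all $n\in N_0$, and, for all $n\in V$, $\gamma(n)$ is a skew critical point at $n$ and is the only skew critical point at $n$ lying in $U$. **Theorem.** Let $(M,h_M)$ and $(N,h_N)$ be manifolds as above, with $N$ paracompact, let $M_0\subseteq h_M^{-1}(0)$ and $N_0\subseteq h_N^{-1}(0)$ be closed $C^k$ submanifolds, $k\ge1$, and let $r\ge1$. For $i=1,2$ let $(\alpha^i,\mathcal D_i,g_i)$ be $C^k$ skew critical problems on $M$ with constraint values in $N$, with distributions of the same typical fiber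 and complement, and let $\gamma_i:V_i\to U_i$ be semiglobal solutions of them along $M_0,N_0$. Suppose that every $n_0\in N_0$ has a neighborhood in which $h_N(n)=0$ implies $h_M(\gamma_1(n))=0$ (this holds, for example, if $N_0=h_N^{-1}(0)$). If $$\alpha^2=\alpha^1+O(h_M^r),\qquad g_2=g_1+O(h_M^r),\qquad \mathcal D_2=\mathcal D_1+O(h_M^r),$$ where the one-forms are compared as maps $M\to T^*M$ and the distributions as maps $m\mapsto(\mathcal D_i)_m$ from $M$ into the Grassmann bundle of $TM$ with fiber type $\mathbb D$, then $$\gamma_2=\gamma_1+O(h_N^r)$$ on some open neighborhood $W$ of $N_0$ with $W\subseteq V_1\cap V_2$. -/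

import Mathlib

open Set Filter Topology Bundle
open scoped Manifold ContDiff

noncomputable section

/-! ### Order of contact of maps relative to a real function -/

/-- A manifold `(M, h)`: the function `h` is smooth and has `0` as a regular value. -/
structure IsOrderFunction {E M : Type*} [NormedAddCommGroup E] [NormedSpace ℝ E]
    [TopologicalSpace M] [ChartedSpace E M] (h : M → ℝ) : Prop where
  contMDiff : ContMDiff 𝓘(ℝ, E) 𝓘(ℝ, ℝ) ∞ h
  regular : ∀ m, h m = 0 → mfderiv 𝓘(ℝ, E) 𝓘(ℝ, ℝ) h m ≠ 0

/-- At the point `m₀`, `f₂ = f₁ + O(h ^ r)`: in some chart `ν` of the target at `f₁ m₀`, one has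
`ν (f₂ m) - ν (f₁ m) = h m ^ r • δ m` for all `m` near `m₀`, with `δ` continuous at `m₀`. -/
def OrderEqAt {M G H P : Type*} [TopologicalSpace M] [NormedAddCommGroup G] [NormedSpace ℝ G]
    [TopologicalSpace H] [TopologicalSpace P] [ChartedSpace H P] (I : ModelWithCorners ℝ G H)
    (h : M → ℝ) (r : ℕ) (f₁ f₂ : M → P) (m₀ : M) : Prop :=
  ∃ ν ∈ atlas H P, f₁ m₀ ∈ ν.source ∧ ∃ δ : M → G, ContinuousAt δ m₀ ∧
    ∀ᶠ m in 𝓝 m₀, f₁ m ∈ ν.source ∧ f₂ m ∈ ν.source ∧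
      ν.extend I (f₂ m) - ν.extend I (f₁ m) = h m ^ r • δ m

/-- `f₂ = f₁ + O(h ^ r)` on the open set `W`: the maps agree on the zeros of `h` in `W`, and
the order condition holds at every such zero. -/
def OrderEqOn {M G H P : Type*} [TopologicalSpace M] [NormedAddCommGroup G] [NormedSpace ℝ G]
    [TopologicalSpace H] [TopologicalSpace P] [ChartedSpace H P] (I : ModelWithCorners ℝ G H)
    (h : M → ℝ) (r : ℕ) (f₁ f₂ : M → P) (W : Set M) : Prop :=
  (∀ m ∈ W, h m = 0 → f₁ m = f₂ m) ∧ ∀ m₀ ∈ W, h m₀ = 0 → OrderEqAt I h r f₁ f₂ m₀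

/-! ### Submanifolds -/

/-- `S` is a closed `C^k` submanifold of `M`: a closed subset which near each of its points is,
in a `C^k` chart, a slice by a closed complemented subspace of the model space. -/
def IsClosedSubmanifold (k : ℕ∞) (E : Type*) {M : Type*} [NormedAddCommGroup E] [NormedSpace ℝ E]
    [TopologicalSpace M] [ChartedSpace E M] (S : Set M) : Prop :=
  IsClosed S ∧ ∀ p ∈ S, ∃ φ ∈ IsManifold.maximalAtlas 𝓘(ℝ, E) (k : WithTop ℕ∞) M,
    p ∈ φ.source ∧ ∃ K : Submodule ℝ E, K.ClosedComplemented ∧ ∀ x ∈ φ.source, x ∈ S ↔ φ x ∈ K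

/-- `f` restricts to a `C^k` diffeomorphism from the submanifold `S` onto the submanifold `T`. -/
def RestrictsToDiffeo (k : ℕ∞) (F E : Type*) {N M : Type*}
    [NormedAddCommGroup E] [NormedSpace ℝ E] [NormedAddCommGroup F] [NormedSpace ℝ F]
    [TopologicalSpace M] [ChartedSpace E M] [TopologicalSpace N] [ChartedSpace F N]
    (f : N → M) (S : Set N) (T : Set M) : Prop :=
  ContMDiffOn 𝓘(ℝ, F) 𝓘(ℝ, E) k f S ∧ MapsTo f S T ∧
    ∃ f' : M → N, ContMDiffOn 𝓘(ℝ, E) 𝓘(ℝ, F) k f' T ∧ MapsTo f' T S ∧ InvOn f' f S T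

/-! ### The Grassmann bundle of the tangent bundle -/

section Grassmann

variable (𝔻 𝔽 E M : Type*)
  [NormedAddCommGroup 𝔻] [NormedSpace ℝ 𝔻] [NormedAddCommGroup 𝔽] [NormedSpace ℝ 𝔽]
  [NormedAddCommGroup E] [NormedSpace ℝ E] [TopologicalSpace M] [ChartedSpace E M]

/-- The linear identification of `T_m M` with the model space `E` given by the chart at `x₀`
(by the preferred chart at `m`, as a junk value, when `m` is not in the domain of that chart). -/
def tangentFrame {E M : Type*} [NormedAddCommGroup E] [NormedSpace ℝ E] [TopologicalSpace M]
    [ChartedSpace E M] [IsManifold 𝓘(ℝ, E) 1 M] (x₀ m : M) :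
    TangentSpace 𝓘(ℝ, E) m ≃L[ℝ] E :=
  open Classical in
  if hm : m ∈ (trivializationAt E (TangentSpace 𝓘(ℝ, E)) x₀).baseSet then
    (trivializationAt E (TangentSpace 𝓘(ℝ, E)) x₀).continuousLinearEquivAt ℝ m hm
  else (trivializationAt E (TangentSpace 𝓘(ℝ, E)) m).continuousLinearEquivAt ℝ m
    (mem_baseSet_trivializationAt E (TangentSpace 𝓘(ℝ, E)) m)

theorem tangentFrame_of_mem {E M : Type*} [NormedAddCommGroup E] [NormedSpace ℝ E]
    [TopologicalSpace M] [ChartedSpace E M] [IsManifold 𝓘(ℝ, E) 1 M] {x₀ m : M}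
    (hm : m ∈ (trivializationAt E (TangentSpace 𝓘(ℝ, E)) x₀).baseSet) :
    tangentFrame x₀ m =
      (trivializationAt E (TangentSpace 𝓘(ℝ, E)) x₀).continuousLinearEquivAt ℝ m hm :=
  dif_pos hm

/-- The bundle over `M` of the subspaces of the tangent spaces of `M` that are the image of
`𝔻 × 0` under some isomorphism of `𝔻 × 𝔽` with the tangent space. -/
structure GrassmannBundle where
  base : M
  fiber : Submodule ℝ (TangentSpace 𝓘(ℝ, E) base)
  split : ∃ L : (𝔻 × 𝔽) ≃L[ℝ] TangentSpace 𝓘(ℝ, E) base, ∀ w, L w ∈ fiber ↔ w.2 = 0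

end Grassmann

namespace GrassmannBundle

variable {𝔻 𝔽 E M : Type*}
  [NormedAddCommGroup 𝔻] [NormedSpace ℝ 𝔻] [NormedAddCommGroup 𝔽] [NormedSpace ℝ 𝔽]
  [NormedAddCommGroup E] [NormedSpace ℝ E] [TopologicalSpace M] [ChartedSpace E M]

/-- The graph of `Δ : 𝔻 → 𝔽` in a vector space that is identified with `𝔻 × 𝔽`. -/
def graph {V : Type*} [AddCommGroup V] [Module ℝ V] [TopologicalSpace V]
    (C : V ≃L[ℝ] 𝔻 × 𝔽) (Δ : 𝔻 →L[ℝ] 𝔽) : Submodule ℝ V where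
  carrier := {v | (C v).2 = Δ (C v).1}
  add_mem' {a b} ha hb := by
    simp only [mem_ofPred_eq] at ha hb ⊢
    simp [ha, hb]
  zero_mem' := by simp
  smul_mem' c a ha := by
    simp only [mem_ofPred_eq] at ha ⊢
    simp [ha]

theorem mem_graph {V : Type*} [AddCommGroup V] [Module ℝ V] [TopologicalSpace V]
    {C : V ≃L[ℝ] 𝔻 × 𝔽} {Δ : 𝔻 →L[ℝ] 𝔽} {v : V} : v ∈ graph C Δ ↔ (C v).2 = Δ (C v).1 :=
  Iff.rfl

theorem graph_injective {V : Type*} [AddCommGroup V] [Module ℝ V] [TopologicalSpace V]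
    {C : V ≃L[ℝ] 𝔻 × 𝔽} {Δ Δ' : 𝔻 →L[ℝ] 𝔽} (h : graph C Δ = graph C Δ') : Δ = Δ' := by
  ext u
  have h1 : C.symm (u, Δ u) ∈ graph C Δ := by simp [mem_graph]
  rw [h] at h1
  simpa [mem_graph] using h1

theorem graph_split {V : Type*} [AddCommGroup V] [Module ℝ V] [TopologicalSpace V]
    (C : V ≃L[ℝ] 𝔻 × 𝔽) (Δ : 𝔻 →L[ℝ] 𝔽) :
    ∃ L : (𝔻 × 𝔽) ≃L[ℝ] V, ∀ w, L w ∈ graph C Δ ↔ w.2 = 0 := by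
  let S : (𝔻 × 𝔽) ≃L[ℝ] (𝔻 × 𝔽) := ContinuousLinearEquiv.equivOfInverse
    ((ContinuousLinearMap.fst ℝ 𝔻 𝔽).prod
      (ContinuousLinearMap.snd ℝ 𝔻 𝔽 + Δ.comp (ContinuousLinearMap.fst ℝ 𝔻 𝔽)))
    ((ContinuousLinearMap.fst ℝ 𝔻 𝔽).prod
      (ContinuousLinearMap.snd ℝ 𝔻 𝔽 - Δ.comp (ContinuousLinearMap.fst ℝ 𝔻 𝔽)))
    (fun w => by simp) (fun w => by simp)
  refine ⟨S.trans C.symm, fun w => ?_⟩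
  simp [mem_graph, S]

/-- The first component of `R` along the graph of `Δ`. -/
def graphFst (R : (𝔻 × 𝔽) →L[ℝ] 𝔻 × 𝔽) (Δ : 𝔻 →L[ℝ] 𝔽) : 𝔻 →L[ℝ] 𝔻 :=
  ((ContinuousLinearMap.fst ℝ 𝔻 𝔽).comp R).comp ((ContinuousLinearMap.id ℝ 𝔻).prod Δ)

/-- The second component of `R` along the graph of `Δ`. -/
def graphSnd (R : (𝔻 × 𝔽) →L[ℝ] 𝔻 × 𝔽) (Δ : 𝔻 →L[ℝ] 𝔽) : 𝔻 →L[ℝ] 𝔽 :=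
  ((ContinuousLinearMap.snd ℝ 𝔻 𝔽).comp R).comp ((ContinuousLinearMap.id ℝ 𝔻).prod Δ)

theorem graph_change {V : Type*} [AddCommGroup V] [Module ℝ V] [TopologicalSpace V]
    (C C' : V ≃L[ℝ] 𝔻 × 𝔽) (Δ : 𝔻 →L[ℝ] 𝔽) (e : 𝔻 ≃L[ℝ] 𝔻)
    (he : (e : 𝔻 →L[ℝ] 𝔻) = graphFst (C.symm.trans C' : (𝔻 × 𝔽) →L[ℝ] 𝔻 × 𝔽) Δ) :
    graph C Δ = graph C'
      ((graphSnd (C.symm.trans C' : (𝔻 × 𝔽) →L[ℝ] 𝔻 × 𝔽) Δ).comp (e.symm : 𝔻 →L[ℝ] 𝔻)) := by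
  have he' : ∀ u, e u = (C' (C.symm (u, Δ u))).1 := fun u => by
    have := congrArg (fun f : 𝔻 →L[ℝ] 𝔻 => f u) he
    simpa [graphFst] using this
  ext v
  simp only [mem_graph]
  constructor
  · intro h
    have h1 : C.symm ((C v).1, Δ (C v).1) = v := by rw [← h]; simp
    have h2 : e (C v).1 = (C' v).1 := by rw [he', h1]
    have h3 : e.symm (C' v).1 = (C v).1 := by rw [← h2]; simp
    simp [graphSnd, h3, h1]
  · intro h
    set w := e.symm (C' v).1 with hw
    have h1 : (C' (C.symm (w, Δ w))).1 = (C' v).1 := by rw [← he', hw]; simp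
    have h2 : (C' (C.symm (w, Δ w))).2 = (C' v).2 := by rw [h]; simp [graphSnd, hw]
    have h3 : C.symm (w, Δ w) = v := C'.injective (Prod.ext h1 h2)
    rw [← h3]
    simp

theorem graph_change_iff {V : Type*} [AddCommGroup V] [Module ℝ V] [TopologicalSpace V]
    (C C' : V ≃L[ℝ] 𝔻 × 𝔽) (Δ : 𝔻 →L[ℝ] 𝔽) :
    (∃ Δ' : 𝔻 →L[ℝ] 𝔽, graph C Δ = graph C' Δ') ↔
      graphFst (C.symm.trans C' : (𝔻 × 𝔽) →L[ℝ] 𝔻 × 𝔽) Δ ∈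
        range ((↑) : (𝔻 ≃L[ℝ] 𝔻) → 𝔻 →L[ℝ] 𝔻) := by
  constructor
  · rintro ⟨Δ', h⟩
    refine ⟨ContinuousLinearEquiv.equivOfInverse
      (graphFst (C.symm.trans C' : (𝔻 × 𝔽) →L[ℝ] 𝔻 × 𝔽) Δ)
      (graphFst (C'.symm.trans C : (𝔻 × 𝔽) →L[ℝ] 𝔻 × 𝔽) Δ') (fun u => ?_) (fun u => ?_), ?_⟩
    · have h1 : C.symm (u, Δ u) ∈ graph C' Δ' := by rw [← h]; simp [mem_graph]
      rw [mem_graph] at h1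
      simp [graphFst, ← h1]
    · have h1 : C'.symm (u, Δ' u) ∈ graph C Δ := by rw [h]; simp [mem_graph]
      rw [mem_graph] at h1
      simp [graphFst, ← h1]
    · ext u
      simp
  · rintro ⟨e, he⟩
    exact ⟨_, graph_change C C' Δ e he⟩

variable [IsManifold 𝓘(ℝ, E) 1 M]

/-- The identification of `T_m M` with `𝔻 × 𝔽` given by the chart at `x₀` and the splitting `L`
of the model space. -/
def frame (x₀ : M) (L : (𝔻 × 𝔽) ≃L[ℝ] E) (m : M) : TangentSpace 𝓘(ℝ, E) m ≃L[ℝ] 𝔻 × 𝔽 :=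
  (tangentFrame x₀ m).trans L.symm

open Classical in
/-- The chart of the Grassmann bundle given by the chart of `M` at `x₀` and the splitting `L` of
the model space: its domain consists of the subspaces `S` of `T_m M`, for `m` in the domain of the
chart at `x₀`, that are the graph of a continuous linear map `Δ : 𝔻 → 𝔽` when `T_m M` is
identified with `𝔻 × 𝔽`; it sends such an `S` to the coordinates of `m` and to `Δ`. -/
def grassmannChart (x₀ : M) (L : (𝔻 × 𝔽) ≃L[ℝ] E) :
    PartialEquiv (GrassmannBundle 𝔻 𝔽 E M) (E × (𝔻 →L[ℝ] 𝔽)) where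
  toFun p := (chartAt E x₀ p.base,
    if h : ∃ Δ : 𝔻 →L[ℝ] 𝔽, p.fiber = graph (frame x₀ L p.base) Δ then h.choose else 0)
  invFun y := ⟨(chartAt E x₀).symm y.1, graph (frame x₀ L _) y.2, graph_split _ _⟩
  source := {p | p.base ∈ (chartAt E x₀).source ∧
    ∃ Δ : 𝔻 →L[ℝ] 𝔽, p.fiber = graph (frame x₀ L p.base) Δ}
  target := (chartAt E x₀).target ×ˢ univ
  map_source' p hp := ⟨(chartAt E x₀).map_source hp.1, mem_univ _⟩
  map_target' y hy := ⟨(chartAt E x₀).map_target hy.1, y.2, rfl⟩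
  left_inv' p hp := by
    obtain ⟨b, f, hs⟩ := p
    obtain ⟨h1, h2⟩ := hp
    have hb : (chartAt E x₀).symm (chartAt E x₀ b) = b := (chartAt E x₀).left_inv h1
    have key : ∀ (b' : M) (_ : b' = b) (Δ : 𝔻 →L[ℝ] 𝔽) (_ : f = graph (frame x₀ L b) Δ),
        (⟨b', graph (frame x₀ L b') Δ, graph_split _ _⟩ : GrassmannBundle 𝔻 𝔽 E M) =
          ⟨b, f, hs⟩ := by
      rintro b' rfl Δ rfl
      rfl
    refine key _ hb _ ?_
    rw [dif_pos h2]
    exact h2.choose_spec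
  right_inv' y hy := by
    have h : ∃ Δ : 𝔻 →L[ℝ] 𝔽, graph (frame x₀ L ((chartAt E x₀).symm y.1)) y.2 =
      graph (frame x₀ L ((chartAt E x₀).symm y.1)) Δ := ⟨_, rfl⟩
    refine Prod.ext ((chartAt E x₀).right_inv hy.1) ?_
    simp only
    rw [dif_pos h]
    exact (graph_injective h.choose_spec).symm

/-- The change of the identification of `T_m M` with `𝔻 × 𝔽`, in the coordinates at `x₀`. -/
def frameChange (x₀ x₁ : M) (L₀ L₁ : (𝔻 × 𝔽) ≃L[ℝ] E) (x : E) : (𝔻 × 𝔽) →L[ℝ] 𝔻 × 𝔽 :=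
  ((frame x₀ L₀ ((chartAt E x₀).symm x)).symm.trans (frame x₁ L₁ ((chartAt E x₀).symm x)) :
    (𝔻 × 𝔽) ≃L[ℝ] 𝔻 × 𝔽)

theorem continuousOn_frameChange (x₀ x₁ : M) (L₀ L₁ : (𝔻 × 𝔽) ≃L[ℝ] E) :
    ContinuousOn (frameChange x₀ x₁ L₀ L₁)
      ((chartAt E x₀).symm.trans (chartAt E x₁)).source := by
  set e₀ := trivializationAt E (TangentSpace 𝓘(ℝ, E)) x₀
  set e₁ := trivializationAt E (TangentSpace 𝓘(ℝ, E)) x₁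
  have h := continuousOn_coordChange ℝ e₀ e₁
  have hm : MapsTo (chartAt E x₀).symm ((chartAt E x₀).symm.trans (chartAt E x₁)).source
      (e₀.baseSet ∩ e₁.baseSet) := by
    intro x hx
    rw [OpenPartialHomeomorph.trans_source] at hx
    exact ⟨(chartAt E x₀).map_target hx.1, hx.2⟩
  have h2 := h.comp ((chartAt E x₀).continuousOn_symm.mono fun x hx => by
    rw [OpenPartialHomeomorph.trans_source] at hx; exact hx.1) hm
  have h3 := (continuousOn_const (c := (L₁.symm : E →L[ℝ] 𝔻 × 𝔽))).clm_comp
    (h2.clm_comp (continuousOn_const (c := (L₀ : (𝔻 × 𝔽) →L[ℝ] E))))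
  refine h3.congr fun x hx => ?_
  have hb := hm hx
  refine ContinuousLinearMap.ext fun w => ?_
  rw [frameChange, frame, frame, tangentFrame_of_mem hb.1, tangentFrame_of_mem hb.2]
  simp [e₀, e₁, Trivialization.coordChangeL_apply _ _ hb]

theorem grassmannChart_trans_source (x₀ x₁ : M) (L₀ L₁ : (𝔻 × 𝔽) ≃L[ℝ] E) :
    ((grassmannChart x₀ L₀).symm.trans (grassmannChart x₁ L₁)).source =
      (((chartAt E x₀).symm.trans (chartAt E x₁)).source ×ˢ univ) ∩
        {y | graphFst (frameChange x₀ x₁ L₀ L₁ y.1) y.2 ∈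
          range ((↑) : (𝔻 ≃L[ℝ] 𝔻) → 𝔻 →L[ℝ] 𝔻)} := by
  ext y
  rw [PartialEquiv.trans_source, OpenPartialHomeomorph.trans_source]
  constructor
  · rintro ⟨h1, h2, h3⟩
    exact ⟨⟨⟨h1.1, h2⟩, mem_univ _⟩, (graph_change_iff _ _ _).1 h3⟩
  · rintro ⟨⟨⟨h1, h2⟩, -⟩, h3⟩
    exact ⟨⟨h1, mem_univ _⟩, h2, (graph_change_iff _ _ _).2 h3⟩

theorem continuousOn_graphFst (x₀ x₁ : M) (L₀ L₁ : (𝔻 × 𝔽) ≃L[ℝ] E) :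
    ContinuousOn (fun y : E × (𝔻 →L[ℝ] 𝔽) => graphFst (frameChange x₀ x₁ L₀ L₁ y.1) y.2)
      (((chartAt E x₀).symm.trans (chartAt E x₁)).source ×ˢ univ) := by
  have h := (continuousOn_frameChange x₀ x₁ L₀ L₁).comp (continuousOn_fst (s :=
    (((chartAt E x₀).symm.trans (chartAt E x₁)).source ×ˢ (univ : Set (𝔻 →L[ℝ] 𝔽)))))
    (fun y hy => hy.1)
  have hp : Continuous fun Δ : 𝔻 →L[ℝ] 𝔽 => (ContinuousLinearMap.id ℝ 𝔻).prod Δ :=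
    (ContinuousLinearMap.prodₗᵢ (𝕜 := ℝ) (E := 𝔻) (F := 𝔻) (G := 𝔽) ℝ).continuous.comp
      (Continuous.prodMk continuous_const continuous_id)
  exact (continuousOn_const.clm_comp h).clm_comp (hp.comp continuous_snd).continuousOn

theorem continuousOn_graphSnd (x₀ x₁ : M) (L₀ L₁ : (𝔻 × 𝔽) ≃L[ℝ] E) :
    ContinuousOn (fun y : E × (𝔻 →L[ℝ] 𝔽) => graphSnd (frameChange x₀ x₁ L₀ L₁ y.1) y.2)
      (((chartAt E x₀).symm.trans (chartAt E x₁)).source ×ˢ univ) := by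
  have h := (continuousOn_frameChange x₀ x₁ L₀ L₁).comp (continuousOn_fst (s :=
    (((chartAt E x₀).symm.trans (chartAt E x₁)).source ×ˢ (univ : Set (𝔻 →L[ℝ] 𝔽)))))
    (fun y hy => hy.1)
  have hp : Continuous fun Δ : 𝔻 →L[ℝ] 𝔽 => (ContinuousLinearMap.id ℝ 𝔻).prod Δ :=
    (ContinuousLinearMap.prodₗᵢ (𝕜 := ℝ) (E := 𝔻) (F := 𝔻) (G := 𝔽) ℝ).continuous.comp
      (Continuous.prodMk continuous_const continuous_id)
  exact (continuousOn_const.clm_comp h).clm_comp (hp.comp continuous_snd).continuousOn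

theorem isOpen_grassmannChart_trans_source [CompleteSpace 𝔻] (x₀ x₁ : M)
    (L₀ L₁ : (𝔻 × 𝔽) ≃L[ℝ] E) :
    IsOpen ((grassmannChart x₀ L₀).symm.trans (grassmannChart x₁ L₁)).source := by
  rw [grassmannChart_trans_source]
  exact (continuousOn_graphFst x₀ x₁ L₀ L₁).isOpen_inter_preimage
    (((chartAt E x₀).symm.trans (chartAt E x₁)).open_source.prod isOpen_univ)
    ContinuousLinearEquiv.isOpen

open Classical in
theorem continuousOn_grassmannChart_trans [CompleteSpace 𝔻] (x₀ x₁ : M)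
    (L₀ L₁ : (𝔻 × 𝔽) ≃L[ℝ] E) :
    ContinuousOn ((grassmannChart x₀ L₀).symm.trans (grassmannChart x₁ L₁))
      ((grassmannChart x₀ L₀).symm.trans (grassmannChart x₁ L₁)).source := by
  have hsub : ((grassmannChart x₀ L₀).symm.trans (grassmannChart x₁ L₁)).source ⊆
      (((chartAt E x₀).symm.trans (chartAt E x₁)).source ×ˢ univ) := by
    rw [grassmannChart_trans_source]; exact inter_subset_left
  have hinv : ContinuousOn (fun y : E × (𝔻 →L[ℝ] 𝔽) =>
      ContinuousLinearMap.inverse (graphFst (frameChange x₀ x₁ L₀ L₁ y.1) y.2))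
      ((grassmannChart x₀ L₀).symm.trans (grassmannChart x₁ L₁)).source := by
    intro y hy
    have hy' := hy
    rw [grassmannChart_trans_source] at hy'
    obtain ⟨e, he⟩ := hy'.2
    have hc : ContinuousAt (ContinuousLinearMap.inverse (R := ℝ) (M := 𝔻) (M₂ := 𝔻))
        (graphFst (frameChange x₀ x₁ L₀ L₁ y.1) y.2) := by
      rw [← he]
      exact (contDiffAt_map_inverse (𝕜 := ℝ) (n := 0) e).continuousAt
    exact ContinuousAt.comp_continuousWithinAt (f := fun y : E × (𝔻 →L[ℝ] 𝔽) =>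
      graphFst (frameChange x₀ x₁ L₀ L₁ y.1) y.2) hc ((continuousOn_graphFst x₀ x₁ L₀ L₁).mono hsub y hy)
  have hbase : ContinuousOn (fun y : E × (𝔻 →L[ℝ] 𝔽) =>
      (chartAt E x₀).symm.trans (chartAt E x₁) y.1)
      ((grassmannChart x₀ L₀).symm.trans (grassmannChart x₁ L₁)).source :=
    ((chartAt E x₀).symm.trans (chartAt E x₁)).continuousOn.comp continuousOn_fst
      fun y hy => (hsub hy).1
  refine (hbase.prodMk (((continuousOn_graphSnd x₀ x₁ L₀ L₁).mono hsub).clm_comp hinv)).congr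
    fun y hy => ?_
  rw [grassmannChart_trans_source] at hy
  obtain ⟨e, he⟩ := hy.2
  have h1 := graph_change _ _ _ e he
  have h2 : ∃ Δ : 𝔻 →L[ℝ] 𝔽, graph (frame x₀ L₀ ((chartAt E x₀).symm y.1)) y.2 =
      graph (frame x₁ L₁ ((chartAt E x₀).symm y.1)) Δ := ⟨_, h1⟩
  refine Prod.ext rfl ?_
  change (if h : ∃ Δ : 𝔻 →L[ℝ] 𝔽, graph (frame x₀ L₀ ((chartAt E x₀).symm y.1)) y.2 =
      graph (frame x₁ L₁ ((chartAt E x₀).symm y.1)) Δ then h.choose else 0) = _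
  rw [dif_pos h2]
  refine graph_injective (h2.choose_spec.symm.trans (h1.trans ?_))
  congr 2
  rw [← he, ContinuousLinearMap.inverse_equiv]

theorem exists_mem_grassmannChart_source (p : GrassmannBundle 𝔻 𝔽 E M) :
    ∃ L : (𝔻 × 𝔽) ≃L[ℝ] E, p ∈ (grassmannChart p.base L).source := by
  obtain ⟨L, hL⟩ := p.split
  refine ⟨L.trans (tangentFrame p.base p.base), mem_chart_source E p.base, 0, ?_⟩
  ext v
  have := hL (L.symm v)
  simp only [ContinuousLinearEquiv.apply_symm_apply] at this
  rw [this]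
  simp [mem_graph, frame]

/-- The charts of the Grassmann bundle. -/
def chartedSpaceCore [CompleteSpace 𝔻] :
    ChartedSpaceCore (E × (𝔻 →L[ℝ] 𝔽)) (GrassmannBundle 𝔻 𝔽 E M) where
  atlas := {e | ∃ (x₀ : M) (L : (𝔻 × 𝔽) ≃L[ℝ] E), e = grassmannChart x₀ L}
  chartAt p := grassmannChart p.base (exists_mem_grassmannChart_source p).choose
  mem_chart_source p := (exists_mem_grassmannChart_source p).choose_spec
  chart_mem_atlas _ := ⟨_, _, rfl⟩
  open_source := by
    rintro _ _ ⟨x₀, L₀, rfl⟩ ⟨x₁, L₁, rfl⟩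
    exact isOpen_grassmannChart_trans_source x₀ x₁ L₀ L₁
  continuousOn_toFun := by
    rintro _ _ ⟨x₀, L₀, rfl⟩ ⟨x₁, L₁, rfl⟩
    exact continuousOn_grassmannChart_trans x₀ x₁ L₀ L₁

instance [CompleteSpace 𝔻] : TopologicalSpace (GrassmannBundle 𝔻 𝔽 E M) :=
  chartedSpaceCore.toTopologicalSpace

instance [CompleteSpace 𝔻] : ChartedSpace (E × (𝔻 →L[ℝ] 𝔽)) (GrassmannBundle 𝔻 𝔽 E M) :=
  chartedSpaceCore.toChartedSpace

end GrassmannBundle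

/-! ### Skew critical problems -/

section Problems

variable (k : ℕ∞) (𝔻 𝔽 E F M N : Type*)
  [NormedAddCommGroup 𝔻] [NormedSpace ℝ 𝔻] [NormedAddCommGroup 𝔽] [NormedSpace ℝ 𝔽]
  [NormedAddCommGroup E] [NormedSpace ℝ E] [NormedAddCommGroup F] [NormedSpace ℝ F]
  [TopologicalSpace M] [ChartedSpace E M] [IsManifold 𝓘(ℝ, E) ∞ M]
  [TopologicalSpace N] [ChartedSpace F N]

/-- A `C^k` distribution on `M` (a `C^k` subbundle of the tangent bundle) with typical fiber `𝔻`
and typical complement `𝔽`: near each point there is a `C^k` local trivialization of `TM` with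
values in `𝔻 × 𝔽` which carries the distribution to `𝔻 × 0`. -/
structure TangentDistribution where
  fiber : ∀ m : M, Submodule ℝ (TangentSpace 𝓘(ℝ, E) m)
  locallyTrivial : ∀ m₀ : M, ∃ U : Set M, IsOpen U ∧ m₀ ∈ U ∧ U ⊆ (chartAt E m₀).source ∧
    ∃ Ψ : M → E ≃L[ℝ] 𝔻 × 𝔽,
      ContMDiffOn 𝓘(ℝ, E) 𝓘(ℝ, E →L[ℝ] 𝔻 × 𝔽) k (fun m => (Ψ m : E →L[ℝ] 𝔻 × 𝔽)) U ∧
      ∀ m ∈ U, ∀ v, v ∈ fiber m ↔ (Ψ m (tangentFrame m₀ m v)).2 = 0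

/-- The map `M → G(𝔻, TM)` which assigns to `m` the fiber of the distribution at `m`. -/
def TangentDistribution.toGrassmann {k : ℕ∞} {𝔻 𝔽 E M : Type*}
    [NormedAddCommGroup 𝔻] [NormedSpace ℝ 𝔻] [NormedAddCommGroup 𝔽] [NormedSpace ℝ 𝔽]
    [NormedAddCommGroup E] [NormedSpace ℝ E]
    [TopologicalSpace M] [ChartedSpace E M] [IsManifold 𝓘(ℝ, E) ∞ M]
    (D : TangentDistribution k 𝔻 𝔽 E M) (m : M) : GrassmannBundle 𝔻 𝔽 E M where
  base := m
  fiber := D.fiber m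
  split := by
    obtain ⟨U, -, hm, -, Ψ, -, h⟩ := D.locallyTrivial m
    exact ⟨((tangentFrame m m).trans (Ψ m)).symm, fun w => by rw [h m hm]; simp⟩

/-- The total space of the cotangent bundle of `M`. -/
abbrev CotangentBundle (E M : Type*) [NormedAddCommGroup E] [NormedSpace ℝ E]
    [TopologicalSpace M] [ChartedSpace E M] : Type _ :=
  TotalSpace (E →L[ℝ] ℝ) (fun m : M => TangentSpace 𝓘(ℝ, E) m →L[ℝ] Trivial M ℝ m)

/-- A `C^k` skew critical problem `(α, 𝒟, g)` on `M` with constraint values in `N`: a `C^k`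
one-form, a `C^k` distribution, and a `C^k` submersion. -/
structure SkewCriticalProblem where
  oneForm : ∀ m : M, TangentSpace 𝓘(ℝ, E) m →L[ℝ] Trivial M ℝ m
  contMDiff_oneForm : ContMDiff 𝓘(ℝ, E) (𝓘(ℝ, E).prod 𝓘(ℝ, E →L[ℝ] ℝ)) k
    (fun m => (⟨m, oneForm m⟩ : CotangentBundle E M))
  dist : TangentDistribution k 𝔻 𝔽 E M
  constraint : M → N
  contMDiff_constraint : ContMDiff 𝓘(ℝ, E) 𝓘(ℝ, F) k constraint
  surjective_mfderiv : ∀ m, Function.Surjective (mfderiv 𝓘(ℝ, E) 𝓘(ℝ, F) constraint m)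
  split_ker : ∀ m, (mfderiv 𝓘(ℝ, E) 𝓘(ℝ, F) constraint m).ker.ClosedComplemented

end Problems

namespace SkewCriticalProblem

variable {k : ℕ∞} {𝔻 𝔽 E F M N : Type*}
  [NormedAddCommGroup 𝔻] [NormedSpace ℝ 𝔻] [NormedAddCommGroup 𝔽] [NormedSpace ℝ 𝔽]
  [NormedAddCommGroup E] [NormedSpace ℝ E] [NormedAddCommGroup F] [NormedSpace ℝ F]
  [TopologicalSpace M] [ChartedSpace E M] [IsManifold 𝓘(ℝ, E) ∞ M]
  [TopologicalSpace N] [ChartedSpace F N]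
  (P : SkewCriticalProblem k 𝔻 𝔽 E F M N)

/-- The one-form of the problem as a map into the cotangent bundle. -/
def oneFormMap (m : M) : CotangentBundle E M := ⟨m, P.oneForm m⟩

/-- `m` is a skew critical point of the problem at `n`. -/
def IsSkewCriticalPoint (m : M) (n : N) : Prop :=
  (∀ v ∈ P.dist.fiber m, P.oneForm m v = 0) ∧ P.constraint m = n

/-- The kernel of the derivative of the constraint at `m`. -/
abbrev kerConstraint (m : M) : Submodule ℝ (TangentSpace 𝓘(ℝ, E) m) :=
  (mfderiv 𝓘(ℝ, E) 𝓘(ℝ, F) P.constraint m).ker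

/-- `V` is a local `C^1` vector field at `m`, with values in the distribution, extending `v`. -/
def IsLocalSection (m : M) (v : TangentSpace 𝓘(ℝ, E) m)
    (V : ∀ x : M, TangentSpace 𝓘(ℝ, E) x) : Prop :=
  ContMDiffAt 𝓘(ℝ, E) 𝓘(ℝ, E).tangent 1 (fun x => (⟨x, V x⟩ : TangentBundle 𝓘(ℝ, E) M)) m ∧
    (∀ᶠ x in 𝓝 m, V x ∈ P.dist.fiber x) ∧ V m = v

/-- `B` is the skew Hessian at `m`, as a map `ker T_m g → 𝒟_m^*`: for `u` in `ker T_m g` and `v`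
in `𝒟_m`, the number `B u v` is the derivative at `m` in the direction `u` of the function
`x ↦ α x (V x)`, for every local vector field `V` with values in `𝒟` such that `V m = v`. -/
def IsSkewHessian (m : M) (B : P.kerConstraint m →L[ℝ] (P.dist.fiber m →L[ℝ] ℝ)) : Prop :=
  ∀ (u : P.kerConstraint m) (v : P.dist.fiber m) (V : ∀ x : M, TangentSpace 𝓘(ℝ, E) x),
    P.IsLocalSection m v V →
      B u v = mfderiv 𝓘(ℝ, E) 𝓘(ℝ, ℝ) (fun x => (P.oneForm x (V x) : ℝ)) m u

/-- `m` is a nondegenerate skew critical point at `n`: its skew Hessian is a linear isomorphism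
`ker T_m g → 𝒟_m^*`. -/
def IsNondegenerate (m : M) (n : N) : Prop :=
  P.IsSkewCriticalPoint m n ∧
    ∃ B : P.kerConstraint m ≃L[ℝ] (P.dist.fiber m →L[ℝ] ℝ), P.IsSkewHessian m B

/-- `γ : V → U` is a semiglobal solution of the problem along the closed submanifolds `M₀` of `M`
and `N₀` of `N`: it is a `C^k` map between open neighborhoods of `N₀` and `M₀` which restricts to
a diffeomorphism `N₀ → M₀` with values in the nondegenerate skew critical points, and `γ n` is the
unique skew critical point at `n` in `U`. -/
structure IsSemiglobalSolution (M₀ U : Set M) (N₀ V : Set N) (γ : N → M) : Prop where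
  closedSubmanifold_M₀ : IsClosedSubmanifold k E M₀
  closedSubmanifold_N₀ : IsClosedSubmanifold k F N₀
  restrictsToDiffeo : RestrictsToDiffeo k F E γ N₀ M₀
  nondegenerate : ∀ n ∈ N₀, P.IsNondegenerate (γ n) n
  isOpen_U : IsOpen U
  M₀_subset : M₀ ⊆ U
  isOpen_V : IsOpen V
  N₀_subset : N₀ ⊆ V
  contMDiffOn : ContMDiffOn 𝓘(ℝ, F) 𝓘(ℝ, E) k γ V
  mapsTo : MapsTo γ V U
  critical : ∀ n ∈ V, P.IsSkewCriticalPoint (γ n) n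
  unique : ∀ n ∈ V, ∀ m ∈ U, P.IsSkewCriticalPoint m n → m = γ n

end SkewCriticalProblem

end

/-!
The proof is local. At `n₀ ∈ N₀` put `m₀ = γ₁ n₀`, work in the charts at `m₀` and `n₀`, and choose
a `C^k` local frame `s` of the first distribution near `m₀`. The skew critical points of the first
problem at `n` are the solutions `y` of the equation `Φ y = (0, n)`, where `Φ` is
`SkewCriticalProblem.localEquation`: its components are the first one-form along the frame and the
first constraint. Nondegeneracy at `m₀` says exactly that the derivative of `Φ` at `m₀` is an
isomorphism, and this persists near `m₀`
(`SkewCriticalProblem.exists_hasStrictFDerivAt_localEquation`).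

At a zero `n` of `h_N` near `n₀`, `h_M (γ₁ n)` vanishes as well, so the two problems agree at `γ₁ n`, which is
therefore a critical point of the second problem; by uniqueness `γ₁ n = γ₂ n`. As a consequence
`h_M ∘ γ₂` vanishes on the zeros of `h_N`, and it is the product of `h_N` with a function
that is continuous at a given zero (`ContMDiffAt.exists_eq_mul_of_zero`).

Evaluated on the second solution, `Φ` differs from `(0, n)` by `h_M ^ r` times a function
continuous at the zero: for the constraint this is the hypothesis, and for the one-form it is
`SkewCriticalProblem.exists_coordForm_comp_frame_eq`, which lifts a vector to both distributions
and compares the one-forms on the lifts. Hence the values of `Φ` on the two solutions have contact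
of order `r` with respect to `h_N`, and the local inverse of `Φ`, being strictly differentiable,
carries this over to the solutions (`HasStrictFDerivAt.exists_smul_eq_sub_comp`). Neither the
second distribution nor the second one-form has to be differentiated.
-/

/-! ### Strictly differentiable maps and order of contact -/

/-- A strictly differentiable map carries maps which agree up to `c • e`, with `e` continuous at
`x₀`, to maps with the same property: the difference quotient `c⁻¹ • (f b₂ - f b₁)` tends to the
derivative applied to `e x₀`. -/
theorem HasStrictFDerivAt.exists_smul_eq_sub_comp {X G G' : Type*} [TopologicalSpace X]
    [NormedAddCommGroup G] [NormedSpace ℝ G] [NormedAddCommGroup G'] [NormedSpace ℝ G']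
    {f : G → G'} {f' : G →L[ℝ] G'} {p : G} (hf : HasStrictFDerivAt f f' p)
    {b₁ b₂ : X → G} {c : X → ℝ} {e : X → G} {x₀ : X}
    (h₁ : Tendsto b₁ (𝓝 x₀) (𝓝 p)) (h₂ : Tendsto b₂ (𝓝 x₀) (𝓝 p)) (he : ContinuousAt e x₀)
    (hb : ∀ᶠ x in 𝓝 x₀, b₂ x - b₁ x = c x • e x) :
    ∃ δ : X → G', ContinuousAt δ x₀ ∧ ∀ᶠ x in 𝓝 x₀, f (b₂ x) - f (b₁ x) = c x • δ x := by
  classical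
  -- where `c` vanishes `δ` is unconstrained; the value `f' (e x)` makes it continuous at `x₀`
  refine ⟨fun x => if c x = 0 then f' (e x) else (c x)⁻¹ • (f (b₂ x) - f (b₁ x)), ?_, ?_⟩
  · have h0 : (fun x => (if c x = 0 then f' (e x) else (c x)⁻¹ • (f (b₂ x) - f (b₁ x))) - f' (e x))
        =o[𝓝 x₀] e := by
      have hlo := hf.isLittleO.comp_tendsto (h₂.prodMk_nhds h₁)
      rw [Asymptotics.isLittleO_iff] at hlo ⊢
      intro ε hε
      filter_upwards [hlo hε, hb] with x hx hbx
      simp only [Function.comp] at hx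
      split_ifs with hc
      · simpa using by positivity
      · have : (c x)⁻¹ • (f (b₂ x) - f (b₁ x)) - f' (e x)
            = (c x)⁻¹ • (f (b₂ x) - f (b₁ x) - f' (b₂ x - b₁ x)) := by
          rw [hbx, map_smul, smul_sub _ _ (c x • _), smul_smul, inv_mul_cancel₀ hc, one_smul]
        rw [this, norm_smul, norm_inv, inv_mul_le_iff₀ (norm_pos_iff.2 hc)]
        rw [hbx, norm_smul] at hx
        rw [hbx]
        linarith
    have h1 := (h0.trans_isBigO (he.norm.isBoundedUnder_le.isBigO_one ℝ)).tendsto_zero_of_tendsto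
      tendsto_const_nhds
    have h2 := h1.add ((f'.continuous.tendsto (e x₀)).comp he)
    exact continuousAt_of_tendsto_nhds (h2.congr fun x => by simp)
  · filter_upwards [hb] with x hbx
    split_ifs with hc
    · rw [hc, zero_smul, sub_eq_zero] at hbx
      simp [hbx, hc]
    · rw [smul_smul, mul_inv_cancel₀ hc, one_smul]

/-- The order condition does not depend on the chart of the target. -/
theorem OrderEqAt.exists_of_mem_atlas {M G H P : Type*} [TopologicalSpace M]
    [NormedAddCommGroup G] [NormedSpace ℝ G] [TopologicalSpace H] [TopologicalSpace P]
    [ChartedSpace H P] {I : ModelWithCorners ℝ G H} [I.Boundaryless] [IsManifold I 1 P]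
    {h : M → ℝ} {r : ℕ} {f₁ f₂ : M → P} {m₀ : M} (hf : OrderEqAt I h r f₁ f₂ m₀)
    (h₁ : ContinuousAt f₁ m₀) (h₂ : ContinuousAt f₂ m₀) (h₀ : f₁ m₀ = f₂ m₀)
    {ν : OpenPartialHomeomorph P H} (hν : ν ∈ atlas H P) (hs : f₁ m₀ ∈ ν.source) :
    ∃ δ : M → G, ContinuousAt δ m₀ ∧ ∀ᶠ m in 𝓝 m₀, f₁ m ∈ ν.source ∧ f₂ m ∈ ν.source ∧
      ν.extend I (f₂ m) - ν.extend I (f₁ m) = h m ^ r • δ m := by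
  obtain ⟨μ, hμ, hsμ, e, he, hev⟩ := hf
  set t := (μ.extend I).symm.trans (ν.extend I)
  have hdiff : ContDiffWithinAt ℝ 1 t (range I) (μ.extend I (f₁ m₀)) := by
    refine ModelWithCorners.contDiffWithinAt_extendCoordChange
      (IsManifold.subset_maximalAtlas hμ) (IsManifold.subset_maximalAtlas hν) ?_
    rw [ModelWithCorners.extendCoordChange, PartialEquiv.trans_source]
    refine ⟨(μ.extend I).map_source (by simpa using hsμ), ?_⟩
    simpa [hsμ] using hs
  rw [I.range_eq_univ, contDiffWithinAt_univ] at hdiff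
  have hc₁ : Tendsto (fun m => μ.extend I (f₁ m)) (𝓝 m₀) (𝓝 (μ.extend I (f₁ m₀))) :=
    ((μ.continuousAt_extend hsμ).tendsto).comp h₁
  have hc₂ : Tendsto (fun m => μ.extend I (f₂ m)) (𝓝 m₀) (𝓝 (μ.extend I (f₁ m₀))) := by
    rw [h₀] at hsμ ⊢
    exact ((μ.continuousAt_extend hsμ).tendsto).comp h₂
  obtain ⟨δ, hδ, hδe⟩ := (hdiff.hasStrictFDerivAt one_ne_zero).exists_smul_eq_sub_comp hc₁ hc₂ he
    (hev.mono fun m hm => hm.2.2)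
  refine ⟨δ, hδ, ?_⟩
  filter_upwards [hev, hδe, h₁.preimage_mem_nhds (ν.open_source.mem_nhds hs),
    h₂.preimage_mem_nhds (ν.open_source.mem_nhds (h₀ ▸ hs))] with m hm hm' hm₁ hm₂
  refine ⟨hm₁, hm₂, ?_⟩
  have key : ∀ q ∈ μ.source, t (μ.extend I q) = ν.extend I q := fun q hq => by simp [t, hq]
  rw [← key _ hm.1, ← key _ hm.2.1, hm']

/-! ### Division by a function with a regular zero -/

/-- A strictly differentiable function `f` which vanishes wherever `h` does is a multiple of `h`,
if `h` has a regular zero at `p`: with `h' w = 1`, every point near `p` is joined to a zero of `h`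
by a segment in the direction `w` of length comparable to `|h|`, and along the segment `f`
varies as `f' w • h` up to a small error. -/
theorem HasStrictFDerivAt.exists_eq_mul_of_zero {F : Type*} [NormedAddCommGroup F]
    [NormedSpace ℝ F] {f h : F → ℝ} {f' h' : F →L[ℝ] ℝ} {p : F} (hf : HasStrictFDerivAt f f' p)
    (hh : HasStrictFDerivAt h h' p) (hc : ∀ᶠ x in 𝓝 p, ContinuousAt h x)
    (hh' : h' ≠ 0) (h0 : h p = 0) (hz : ∀ᶠ x in 𝓝 p, h x = 0 → f x = 0) :
    ∃ q : F → ℝ, ContinuousAt q p ∧ ∀ᶠ x in 𝓝 p, f x = h x * q x := by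
  classical
  obtain ⟨w, hw⟩ : ∃ w, h' w = 1 := by
    obtain ⟨w, hw⟩ : ∃ w, h' w ≠ 0 := by
      by_contra! H
      exact hh' (ContinuousLinearMap.ext H)
    exact ⟨(h' w)⁻¹ • w, by simp [hw]⟩
  -- the nearby zero of `h` on the line through `x` in the direction `w`
  have hzero : ∀ s ∈ 𝓝 p, ∀ᶠ x in 𝓝 p, ∃ t : ℝ, |t| ≤ 2 * |h x| ∧ x + t • w ∈ s ∧
      h (x + t • w) = 0 := by
    intro s hs
    have hlo := Asymptotics.isLittleO_iff.1 hh.isLittleO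
      (c := (2 * (‖w‖ + 1))⁻¹) (by positivity)
    rw [nhds_prod_eq] at hlo
    obtain ⟨v, hv, hlo⟩ := mem_prod_self_iff.1 hlo
    obtain ⟨ρ, hρ, hball⟩ := Metric.mem_nhds_iff.1 (inter_mem (inter_mem hv hs) hc)
    have hsmall : ∀ᶠ x in 𝓝 p, ‖x - p‖ + 2 * |h x| * ‖w‖ < ρ := by
      have : ContinuousAt (fun x => ‖x - p‖ + 2 * |h x| * ‖w‖) p := by
        have := hh.continuousAt
        fun_prop
      exact this.eventually_lt continuousAt_const (by simpa [h0] using hρ)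
    filter_upwards [hsmall] with x hx
    have hmem : ∀ t : ℝ, |t| ≤ 2 * |h x| → x + t • w ∈ Metric.ball p ρ := by
      intro t ht
      rw [mem_ball_iff_norm]
      calc ‖x + t • w - p‖ = ‖(x - p) + t • w‖ := by congr 1; abel
        _ ≤ ‖x - p‖ + |t| * ‖w‖ := (norm_add_le _ _).trans (by rw [norm_smul, Real.norm_eq_abs])
        _ ≤ ‖x - p‖ + 2 * |h x| * ‖w‖ := by gcongr
        _ < ρ := hx
    have hxm : x ∈ Metric.ball p ρ := by simpa using hmem 0 (by simp)
    -- `h` grows along the line with slope at least `1 / 2`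
    have hest : ∀ t : ℝ, |t| ≤ 2 * |h x| → |h (x + t • w) - h x - t| ≤ |t| / 2 := by
      intro t ht
      have := hlo (mk_mem_prod (hball (hmem t ht)).1.1 (hball hxm).1.1)
      simp only [mem_ofPred_eq, add_sub_cancel_left, map_smul, hw, smul_eq_mul, mul_one, norm_smul,
        Real.norm_eq_abs] at this
      refine this.trans ?_
      rw [inv_mul_le_iff₀ (by positivity)]
      nlinarith [abs_nonneg t, norm_nonneg w]
    set a := 2 * |h x| with ha
    have ha0 : 0 ≤ a := by positivity
    have hcont : ContinuousOn (fun t : ℝ => h (x + t • w)) (Icc (-a) a) := by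
      intro t ht
      have h1 : ContinuousAt h (x + t • w) := (hball (hmem t (abs_le.2 ht))).2
      have h2 : ContinuousAt (fun t : ℝ => x + t • w) t := by fun_prop
      exact (ContinuousAt.comp (f := fun t : ℝ => x + t • w) h1 h2).continuousWithinAt
    have hle := abs_le.1 (hest (-a) (by rw [abs_neg, abs_of_nonneg ha0]))
    have hge := abs_le.1 (hest a (by rw [abs_of_nonneg ha0]))
    rw [abs_neg, abs_of_nonneg ha0] at hle
    rw [abs_of_nonneg ha0] at hge
    have hax := abs_le.1 (le_refl |h x|)
    obtain ⟨t, ht, ht0⟩ := intermediate_value_Icc (by linarith : -a ≤ a) hcont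
      (show (0 : ℝ) ∈ Icc (h (x + (-a) • w)) (h (x + a • w)) from
        ⟨by linarith [hle.2, hax.2], by linarith [hge.1, hax.1]⟩)
    exact ⟨t, abs_le.2 ht, (hball (hmem t (abs_le.2 ht))).1.2, ht0⟩
  -- the derivative of `f - f' w • h` in the direction `w` vanishes, so this function is small
  -- compared with the distance in the direction `w` to the zero of `h` found above
  have hE : (fun x => f x - h x * f' w) =o[𝓝 p] h := by
    have hk : HasStrictFDerivAt (fun x => f x - h x * f' w) (f' - (f' w) • h') p :=
      hf.sub (by simpa using hh.mul_const' (f' w))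
    rw [Asymptotics.isLittleO_iff]
    intro ε hε
    have hlo := Asymptotics.isLittleO_iff.1 hk.isLittleO
      (c := ε / (2 * (‖w‖ + 1))) (by positivity)
    rw [nhds_prod_eq] at hlo
    obtain ⟨v, hv, hlo⟩ := mem_prod_self_iff.1 hlo
    filter_upwards [hzero _ (inter_mem hv hz), hv] with x ⟨t, ht, hts, ht0⟩ hxv
    have := hlo (mk_mem_prod hts.1 hxv)
    simp only [mem_ofPred_eq, hts.2 ht0, ht0, add_sub_cancel_left, map_smul, sub_apply,
      smul_apply, hw, smul_eq_mul, mul_one, sub_self, zero_mul,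
      zero_sub, norm_smul] at this
    rw [mul_comm (f' w) t, sub_self, sub_zero, norm_neg] at this
    refine this.trans ?_
    rw [div_mul_eq_mul_div, div_le_iff₀ (by positivity)]
    rw [Real.norm_eq_abs, Real.norm_eq_abs]
    have h3 : |t| * ‖w‖ ≤ 2 * |h x| * (‖w‖ + 1) := by
      gcongr
      linarith
    nlinarith [mul_le_mul_of_nonneg_left h3 hε.le]
  refine ⟨fun x => if h x = 0 then f' w else f x / h x, ?_, ?_⟩
  · have h1 : Tendsto (fun x => (f x - h x * f' w) / h x + f' w) (𝓝 p) (𝓝 (0 + f' w)) :=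
      hE.tendsto_div_nhds_zero.add_const _
    refine continuousAt_of_tendsto_nhds (y := 0 + f' w) (h1.congr fun x => ?_)
    split_ifs with hx
    · simp [hx]
    · field_simp
      ring
  · filter_upwards [hz] with x hx
    split_ifs with h2
    · simp [hx h2, h2]
    · field_simp

theorem MDifferentiableAt.mfderiv_eq_fderiv_chart {E F M N : Type*}
    [NormedAddCommGroup E] [NormedSpace ℝ E] [NormedAddCommGroup F] [NormedSpace ℝ F]
    [TopologicalSpace M] [ChartedSpace E M] [TopologicalSpace N] [ChartedSpace F N]
    {f : M → N} {m : M} (hf : MDifferentiableAt 𝓘(ℝ, E) 𝓘(ℝ, F) f m) :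
    mfderiv 𝓘(ℝ, E) 𝓘(ℝ, F) f m =
      fderiv ℝ (fun y => chartAt F (f m) (f ((chartAt E m).symm y))) (chartAt E m m) := by
  rw [hf.mfderiv]
  simp [writtenInExtChartAt, Function.comp_def]
  rfl

theorem ContMDiffAt.contDiffAt_chart {E F M N : Type*}
    [NormedAddCommGroup E] [NormedSpace ℝ E] [NormedAddCommGroup F] [NormedSpace ℝ F]
    [TopologicalSpace M] [ChartedSpace E M] [TopologicalSpace N] [ChartedSpace F N]
    {n : WithTop ℕ∞} {f : M → N} {m : M} (hf : ContMDiffAt 𝓘(ℝ, E) 𝓘(ℝ, F) n f m) :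
    ContDiffAt ℝ n (fun y => chartAt F (f m) (f ((chartAt E m).symm y))) (chartAt E m m) := by
  have := (contMDiffAt_iff.1 hf).2
  simpa [contDiffWithinAt_univ, Function.comp_def] using this

/-- Division on a manifold by a `C^1` function with a regular zero. -/
theorem ContMDiffAt.exists_eq_mul_of_zero {F N : Type*} [NormedAddCommGroup F] [NormedSpace ℝ F]
    [TopologicalSpace N] [ChartedSpace F N] {f h : N → ℝ} {p : N}
    (hf : ContMDiffAt 𝓘(ℝ, F) 𝓘(ℝ, ℝ) 1 f p) (hh : ContMDiffAt 𝓘(ℝ, F) 𝓘(ℝ, ℝ) 1 h p)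
    (hh' : mfderiv 𝓘(ℝ, F) 𝓘(ℝ, ℝ) h p ≠ 0) (h0 : h p = 0)
    (hz : ∀ᶠ x in 𝓝 p, h x = 0 → f x = 0) :
    ∃ q : N → ℝ, ContinuousAt q p ∧ ∀ᶠ x in 𝓝 p, f x = h x * q x := by
  set φ := chartAt F p
  have hps : p ∈ φ.source := mem_chart_source F p
  have hsymm : φ.symm (φ p) = p := φ.left_inv hps
  have htend : Tendsto φ.symm (𝓝 (φ p)) (𝓝 p) := by
    have := φ.continuousAt_symm (φ.map_source hps)
    rwa [ContinuousAt, hsymm] at this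
  have hcd : ∀ {u : N → ℝ}, ContMDiffAt 𝓘(ℝ, F) 𝓘(ℝ, ℝ) 1 u p →
      ContDiffAt ℝ 1 (fun y => u (φ.symm y)) (φ p) := fun hu => by
    have := hu.contDiffAt_chart
    simpa only [chartAt_self_eq, OpenPartialHomeomorph.refl_apply, id_eq] using this
  have hd : mfderiv 𝓘(ℝ, F) 𝓘(ℝ, ℝ) h p = fderiv ℝ (fun y => h (φ.symm y)) (φ p) := by
    rw [(hh.mdifferentiableAt one_ne_zero).mfderiv_eq_fderiv_chart]
    simp only [chartAt_self_eq, OpenPartialHomeomorph.refl_apply]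
    rfl
  obtain ⟨q, hq, hqe⟩ := ((hcd hf).hasStrictFDerivAt one_ne_zero).exists_eq_mul_of_zero
    ((hcd hh).hasStrictFDerivAt one_ne_zero)
    (((hcd hh).eventually (by simp)).mono fun x hx => hx.continuousAt)
    (by rw [← hd]; exact hh') (by simp [hsymm, h0]) (htend.eventually hz)
  have hφ := φ.continuousAt hps
  refine ⟨q ∘ φ, ContinuousAt.comp hq hφ, ?_⟩
  filter_upwards [hφ.eventually hqe, φ.open_source.mem_nhds hps] with x hx hxs
  simpa [φ.left_inv hxs] using hx

section LocalTheory

variable {k : ℕ∞} {𝔻 𝔽 E F M N : Type*}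
  [NormedAddCommGroup 𝔻] [NormedSpace ℝ 𝔻] [NormedAddCommGroup 𝔽] [NormedSpace ℝ 𝔽]
  [NormedAddCommGroup E] [NormedSpace ℝ E] [NormedAddCommGroup F] [NormedSpace ℝ F]
  [TopologicalSpace M] [ChartedSpace E M] [IsManifold 𝓘(ℝ, E) ∞ M]
  [TopologicalSpace N] [ChartedSpace F N]

/-! ### Coordinates in the tangent and cotangent bundles -/

theorem mem_baseSet_trivializationAt_tangent {m₀ m : M} :
    m ∈ (trivializationAt E (TangentSpace 𝓘(ℝ, E)) m₀).baseSet ↔ m ∈ (chartAt E m₀).source := by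
  rw [TangentBundle.trivializationAt_baseSet]

theorem trivializationAt_tangent_snd {m₀ m : M} (hm : m ∈ (chartAt E m₀).source)
    (v : TangentSpace 𝓘(ℝ, E) m) :
    (trivializationAt E (TangentSpace 𝓘(ℝ, E)) m₀ ⟨m, v⟩).2 = tangentFrame m₀ m v := by
  have hb := mem_baseSet_trivializationAt_tangent.2 hm
  rw [tangentFrame_of_mem hb]
  simp [Trivialization.continuousLinearEquivAt_apply]

/-- The change of the identification of the tangent spaces with the model space, from the chart at
`m₀` to the chart at `m₁`, is continuous. -/
theorem continuousAt_tangentFrame_change {m₀ m₁ m : M} (h₀ : m ∈ (chartAt E m₀).source)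
    (h₁ : m ∈ (chartAt E m₁).source) :
    ContinuousAt (fun x => (((tangentFrame m₀ x).symm.trans (tangentFrame m₁ x) : E ≃L[ℝ] E) :
      E →L[ℝ] E)) m := by
  have hb : m ∈ (trivializationAt E (TangentSpace 𝓘(ℝ, E)) m₀).baseSet ∩
      (trivializationAt E (TangentSpace 𝓘(ℝ, E)) m₁).baseSet :=
    ⟨mem_baseSet_trivializationAt_tangent.2 h₀, mem_baseSet_trivializationAt_tangent.2 h₁⟩
  have hn : _ ∈ 𝓝 m := ((trivializationAt E (TangentSpace 𝓘(ℝ, E)) m₀).open_baseSet.inter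
    (trivializationAt E (TangentSpace 𝓘(ℝ, E)) m₁).open_baseSet).mem_nhds hb
  refine ((continuousOn_coordChange ℝ (trivializationAt E (TangentSpace 𝓘(ℝ, E)) m₀)
    (trivializationAt E (TangentSpace 𝓘(ℝ, E)) m₁)).continuousAt hn).congr ?_
  filter_upwards [hn] with x hx
  refine ContinuousLinearMap.ext fun w => ?_
  rw [tangentFrame_of_mem hx.1, tangentFrame_of_mem hx.2]
  simp [Trivialization.coordChangeL_apply _ _ hx]

namespace SkewCriticalProblem

variable (P : SkewCriticalProblem k 𝔻 𝔽 E F M N)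

/-- The one-form of the problem at `m`, as a functional on the model space by means of the chart
at `m₀`; off the domain of that chart it has the junk value coming from `tangentFrame`. -/
noncomputable def coordForm (m₀ m : M) : E →L[ℝ] ℝ :=
  (P.oneForm m : TangentSpace 𝓘(ℝ, E) m →L[ℝ] ℝ).comp
    ((tangentFrame (E := E) m₀ m).symm : E →L[ℝ] TangentSpace 𝓘(ℝ, E) m)

theorem coordForm_apply (m₀ m : M) (w : E) :
    P.coordForm m₀ m w = P.oneForm m ((tangentFrame m₀ m).symm w) := rfl

theorem inCoordinates_oneForm {m₀ m : M} (hm : m ∈ (chartAt E m₀).source) :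
    ContinuousLinearMap.inCoordinates E (TangentSpace 𝓘(ℝ, E)) ℝ (Trivial M ℝ) m₀ m m₀ m
      (P.oneForm m) = P.coordForm m₀ m := by
  have hb := mem_baseSet_trivializationAt_tangent.2 hm
  rw [ContinuousLinearMap.inCoordinates_eq hb (by simp)]
  refine ContinuousLinearMap.ext fun w => ?_
  rw [coordForm_apply, tangentFrame_of_mem hb]
  simp

theorem contMDiffAt_coordForm (m₀ : M) :
    ContMDiffAt 𝓘(ℝ, E) 𝓘(ℝ, E →L[ℝ] ℝ) k (P.coordForm m₀) m₀ := by
  have h := ((contMDiffAt_hom_bundle _).1 (P.contMDiff_oneForm m₀)).2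
  refine h.congr_of_eventuallyEq ?_
  filter_upwards [(chartAt E m₀).open_source.mem_nhds (mem_chart_source E m₀)] with m hm
  exact (P.inCoordinates_oneForm hm).symm

theorem mem_trivializationAt_oneFormMap_source {m₀ m : M} (hm : m ∈ (chartAt E m₀).source) :
    P.oneFormMap m ∈ (trivializationAt (E →L[ℝ] ℝ)
      (fun m : M => TangentSpace 𝓘(ℝ, E) m →L[ℝ] Trivial M ℝ m) m₀).source := by
  rw [Trivialization.mem_source, hom_trivializationAt_baseSet]
  exact ⟨mem_baseSet_trivializationAt_tangent.2 hm, by simp⟩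

theorem trivializationAt_oneFormMap_snd {m₀ m : M} (hm : m ∈ (chartAt E m₀).source) :
    (trivializationAt (E →L[ℝ] ℝ) (fun m : M => TangentSpace 𝓘(ℝ, E) m →L[ℝ] Trivial M ℝ m) m₀
      (P.oneFormMap m)).2 = P.coordForm m₀ m := by
  rw [hom_trivializationAt_apply]
  exact P.inCoordinates_oneForm hm

theorem continuousAt_coordForm {m₀ m : M} (hm : m ∈ (chartAt E m₀).source) :
    ContinuousAt (P.coordForm m₀) m := by
  have h := (((trivializationAt (E →L[ℝ] ℝ) (fun m : M => TangentSpace 𝓘(ℝ, E) m →L[ℝ]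
    Trivial M ℝ m) m₀).continuousAt (P.mem_trivializationAt_oneFormMap_source hm)).comp
    (f := P.oneFormMap) P.contMDiff_oneForm.continuous.continuousAt).snd
  refine h.congr ?_
  filter_upwards [(chartAt E m₀).open_source.mem_nhds hm] with x hx
  exact P.trivializationAt_oneFormMap_snd hx

/-- In the chart at `m₀`, the order of contact of one-forms is that of their coordinate
expressions. -/
theorem exists_coordForm_sub_eq {P₁ P₂ : SkewCriticalProblem k 𝔻 𝔽 E F M N} {h : M → ℝ} {r : ℕ}
    {m₀ m : M} (hm : m ∈ (chartAt E m₀).source)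
    (hα : OrderEqAt (𝓘(ℝ, E).prod 𝓘(ℝ, E →L[ℝ] ℝ)) h r P₁.oneFormMap P₂.oneFormMap m)
    (h₀ : P₁.oneFormMap m = P₂.oneFormMap m) :
    ∃ β : M → E →L[ℝ] ℝ, ContinuousAt β m ∧
      ∀ᶠ x in 𝓝 m, P₂.coordForm m₀ x - P₁.coordForm m₀ x = h x ^ r • β x := by
  obtain ⟨δ, hδ, hev⟩ := hα.exists_of_mem_atlas P₁.contMDiff_oneForm.continuous.continuousAt
    P₂.contMDiff_oneForm.continuous.continuousAt h₀
    (ν := chartAt (ModelProd E (E →L[ℝ] ℝ)) (⟨m₀, 0⟩ : CotangentBundle E M))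
    (chart_mem_atlas _ _) (by
      rw [FiberBundle.chartedSpace_chartAt]
      have hb := mem_trivializationAt_oneFormMap_source P₁ hm
      rw [OpenPartialHomeomorph.trans_source]
      refine ⟨hb, ?_⟩
      have hm' : (P₁.oneFormMap m).proj ∈ (chartAt E m₀).source := hm
      simpa [(trivializationAt (E →L[ℝ] ℝ) (fun m : M => TangentSpace 𝓘(ℝ, E) m →L[ℝ]
        Trivial M ℝ m) m₀).coe_fst hb] using hm')
  refine ⟨fun x => (δ x).2, hδ.snd, ?_⟩
  filter_upwards [hev, (chartAt E m₀).open_source.mem_nhds hm] with x hx hxs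
  have h2 := congrArg Prod.snd hx.2.2
  rw [FiberBundle.chartedSpace_chartAt] at h2
  rw [← P₁.trivializationAt_oneFormMap_snd hxs, ← P₂.trivializationAt_oneFormMap_snd hxs]
  simpa using h2

end SkewCriticalProblem

/-! ### Distributions -/

theorem GrassmannBundle.exists_eq_grassmannChart [CompleteSpace 𝔻]
    {ν : OpenPartialHomeomorph (GrassmannBundle 𝔻 𝔽 E M) (E × (𝔻 →L[ℝ] 𝔽))}
    (hν : ν ∈ atlas (E × (𝔻 →L[ℝ] 𝔽)) (GrassmannBundle 𝔻 𝔽 E M)) :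
    ∃ (x₁ : M) (L : (𝔻 × 𝔽) ≃L[ℝ] E), ν.toPartialEquiv = grassmannChart x₁ L := by
  obtain ⟨_, ⟨e, rfl⟩, _, ⟨he, rfl⟩, rfl⟩ := hν
  obtain ⟨x₁, L, rfl⟩ := he
  exact ⟨x₁, L, rfl⟩

open Classical in
theorem GrassmannBundle.fiber_eq_graph {x₁ : M} {L : (𝔻 × 𝔽) ≃L[ℝ] E}
    {p : GrassmannBundle 𝔻 𝔽 E M} (hp : p ∈ (grassmannChart x₁ L).source) :
    p.fiber = graph (frame x₁ L p.base) (grassmannChart x₁ L p).2 := by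
  have h := hp.2
  change _ = graph _ (dite _ _ _)
  rw [dif_pos h]
  exact h.choose_spec

namespace TangentDistribution

/-- Distributions with contact of order `r` are near `m`, in a common splitting of the tangent
spaces, graphs of linear maps with contact of order `r`. -/
theorem exists_graph_sub_eq [CompleteSpace 𝔻] {D₁ D₂ : TangentDistribution k 𝔻 𝔽 E M}
    {h : M → ℝ} {r : ℕ} {m : M}
    (hD : OrderEqAt 𝓘(ℝ, E × (𝔻 →L[ℝ] 𝔽)) h r D₁.toGrassmann D₂.toGrassmann m) :
    ∃ (x₁ : M) (L : (𝔻 × 𝔽) ≃L[ℝ] E) (Δ₁ Δ₂ δ : M → 𝔻 →L[ℝ] 𝔽),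
      m ∈ (chartAt E x₁).source ∧ ContinuousAt δ m ∧ ∀ᶠ x in 𝓝 m,
        D₁.fiber x = GrassmannBundle.graph (GrassmannBundle.frame x₁ L x) (Δ₁ x) ∧
        D₂.fiber x = GrassmannBundle.graph (GrassmannBundle.frame x₁ L x) (Δ₂ x) ∧
        Δ₂ x - Δ₁ x = h x ^ r • δ x := by
  obtain ⟨ν, hν, hs, δ, hδ, hev⟩ := hD
  obtain ⟨x₁, L, hL⟩ := GrassmannBundle.exists_eq_grassmannChart hν
  have hsrc : ν.source = (GrassmannBundle.grassmannChart x₁ L).source := by rw [← hL]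
  have hcoe : ∀ p, ν p = GrassmannBundle.grassmannChart x₁ L p := fun p => by rw [← hL]; rfl
  rw [hsrc] at hs
  refine ⟨x₁, L, fun x => (ν (D₁.toGrassmann x)).2, fun x => (ν (D₂.toGrassmann x)).2,
    fun x => (δ x).2, hs.1, hδ.snd, ?_⟩
  filter_upwards [hev] with x ⟨h₁, h₂, h₃⟩
  rw [hsrc] at h₁ h₂
  refine ⟨?_, ?_, by simpa using congrArg Prod.snd h₃⟩
  · simp only [hcoe]
    exact GrassmannBundle.fiber_eq_graph h₁
  · simp only [hcoe]
    exact GrassmannBundle.fiber_eq_graph h₂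

/-- A distribution has near each point a `C^k` local frame, as a family of linear maps from the
typical fiber to the model space of the manifold. At the base point it is an isomorphism `e` onto
the fiber. -/
theorem exists_local_frame [CompleteSpace E] (D : TangentDistribution k 𝔻 𝔽 E M) (m₀ : M) :
    ∃ (U : Set M) (s : M → 𝔻 →L[ℝ] E), IsOpen U ∧ m₀ ∈ U ∧
      ContMDiffOn 𝓘(ℝ, E) 𝓘(ℝ, 𝔻 →L[ℝ] E) k s U ∧
      (∀ m ∈ U, ∀ d, (tangentFrame m₀ m).symm (s m d) ∈ D.fiber m) ∧
      ∃ e : 𝔻 ≃L[ℝ] D.fiber m₀, ∀ d, (e d : TangentSpace 𝓘(ℝ, E) m₀) =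
        (tangentFrame m₀ m₀).symm (s m₀ d) := by
  obtain ⟨U, hU, hm₀, -, Ψ, hΨ, hfib⟩ := D.locallyTrivial m₀
  set s : M → 𝔻 →L[ℝ] E := fun m =>
    ((Ψ m).symm : 𝔻 × 𝔽 →L[ℝ] E).comp (ContinuousLinearMap.inl ℝ 𝔻 𝔽) with hs
  have hmem : ∀ m ∈ U, ∀ d, (tangentFrame m₀ m).symm (s m d) ∈ D.fiber m := fun m hm d => by
    rw [hfib m hm]
    simp [hs]
  refine ⟨U, s, hU, hm₀, ?_, hmem, ContinuousLinearEquiv.equivOfInverse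
    ((((tangentFrame (E := E) m₀ m₀).symm : E →L[ℝ] TangentSpace 𝓘(ℝ, E) m₀).comp (s m₀)).codRestrict
      (D.fiber m₀) fun d => hmem m₀ hm₀ d)
    (((ContinuousLinearMap.fst ℝ 𝔻 𝔽).comp ((Ψ m₀ : E →L[ℝ] 𝔻 × 𝔽).comp
      (tangentFrame (E := E) m₀ m₀ : TangentSpace 𝓘(ℝ, E) m₀ →L[ℝ] E))).comp (D.fiber m₀).subtypeL)
    (fun d => ?_) (fun v => ?_), fun d => rfl⟩
  · intro m hm
    have h1 : ContMDiffAt 𝓘(ℝ, E) 𝓘(ℝ, (𝔻 × 𝔽) →L[ℝ] E) k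
        (fun m => ((Ψ m).symm : 𝔻 × 𝔽 →L[ℝ] E)) m := by
      have h2 := ((contDiffAt_map_inverse (𝕜 := ℝ) (n := k) (Ψ m)).contMDiffAt).comp m
        ((hΨ m hm).contMDiffAt (hU.mem_nhds hm))
      refine h2.congr_of_eventuallyEq (Eventually.of_forall fun x => ?_)
      simp
    exact (h1.clm_comp contMDiffAt_const).contMDiffWithinAt
  · simp [hs]
  · obtain ⟨v, hv⟩ := v
    have h1 := (hfib m₀ hm₀ v).1 hv
    have h2 : ((Ψ m₀ (tangentFrame m₀ m₀ v)).1, (0 : 𝔽)) = Ψ m₀ (tangentFrame m₀ m₀ v) :=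
      Prod.ext rfl h1.symm
    refine Subtype.ext ?_
    simp [hs, h2]

end TangentDistribution

namespace SkewCriticalProblem

/-- Along a local frame `s` of the first distribution, the first one-form is of the order of
`h ^ r` at the points where the second one-form annihilates the second distribution: both the
difference of the one-forms and the difference of the two lifts of a vector to the distributions
are of that order. -/
theorem exists_coordForm_comp_frame_eq [CompleteSpace 𝔻]
    {P₁ P₂ : SkewCriticalProblem k 𝔻 𝔽 E F M N} {h : M → ℝ} {r : ℕ} {m₀ m : M}
    (hm : m ∈ (chartAt E m₀).source)
    (hα : OrderEqAt (𝓘(ℝ, E).prod 𝓘(ℝ, E →L[ℝ] ℝ)) h r P₁.oneFormMap P₂.oneFormMap m)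
    (h₀ : P₁.oneFormMap m = P₂.oneFormMap m)
    (hD : OrderEqAt 𝓘(ℝ, E × (𝔻 →L[ℝ] 𝔽)) h r P₁.dist.toGrassmann P₂.dist.toGrassmann m)
    {s : M → 𝔻 →L[ℝ] E} (hs : ContinuousAt s m)
    (hsD : ∀ᶠ x in 𝓝 m, ∀ d, (tangentFrame m₀ x).symm (s x d) ∈ P₁.dist.fiber x) :
    ∃ ε : M → 𝔻 →L[ℝ] ℝ, ContinuousAt ε m ∧ ∀ᶠ x in 𝓝 m,
      (∀ v ∈ P₂.dist.fiber x, P₂.oneForm x v = 0) →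
        (P₁.coordForm m₀ x).comp (s x) = h x ^ r • ε x := by
  obtain ⟨β, hβ, hβe⟩ := exists_coordForm_sub_eq hm hα h₀
  obtain ⟨x₁, L, Δ₁, Δ₂, δ, hx₁, hδ, hΔ⟩ := TangentDistribution.exists_graph_sub_eq hD
  set K : M → E →L[ℝ] E := fun x =>
    (((tangentFrame m₀ x).symm.trans (tangentFrame x₁ x) : E ≃L[ℝ] E) : E →L[ℝ] E) with hK
  set K' : M → E →L[ℝ] E := fun x =>
    (((tangentFrame x₁ x).symm.trans (tangentFrame m₀ x) : E ≃L[ℝ] E) : E →L[ℝ] E) with hK'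
  have hKc : ContinuousAt K m := continuousAt_tangentFrame_change hm hx₁
  have hKc' : ContinuousAt K' m := continuousAt_tangentFrame_change hx₁ hm
  -- the change of the lift of the vector with first component `d` from one graph to the other
  set τ : M → 𝔻 →L[ℝ] E := fun x => (K' x).comp ((L : (𝔻 × 𝔽) →L[ℝ] E).comp
    ((ContinuousLinearMap.inr ℝ 𝔻 𝔽).comp ((δ x).comp ((ContinuousLinearMap.fst ℝ 𝔻 𝔽).comp
      ((L.symm : E →L[ℝ] 𝔻 × 𝔽).comp ((K x).comp (s x))))))) with hτ
  have hτc : ContinuousAt τ m :=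
    hKc'.clm_comp (continuousAt_const.clm_comp (continuousAt_const.clm_comp (hδ.clm_comp
      (continuousAt_const.clm_comp (continuousAt_const.clm_comp (hKc.clm_comp hs))))))
  refine ⟨fun x => -((β x).comp (s x) + (P₂.coordForm m₀ x).comp (τ x)),
    ((hβ.clm_comp hs).add ((P₂.continuousAt_coordForm hm).clm_comp hτc)).neg, ?_⟩
  filter_upwards [hβe, hΔ, hsD] with x hβx ⟨hΔ₁, hΔ₂, hΔx⟩ hsx hcrit
  ext d
  -- this is the lift to the second distribution of the vector lifted by `s` to the first one
  have hmem : (tangentFrame m₀ x).symm (s x d + h x ^ r • τ x d) ∈ P₂.dist.fiber x := by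
    have h1 := hsx d
    rw [hΔ₁, GrassmannBundle.mem_graph] at h1
    rw [hΔ₂, GrassmannBundle.mem_graph]
    have h2 : Δ₂ x = Δ₁ x + h x ^ r • δ x := by rw [← hΔx]; abel
    simp only [GrassmannBundle.frame, ContinuousLinearEquiv.trans_apply] at h1 ⊢
    simp [hτ, hK, hK', h2, h1]
  have h3 := hcrit _ hmem
  rw [← coordForm_apply, map_add, map_smul] at h3
  have h4 := congrArg (fun f : E →L[ℝ] ℝ => f (s x d)) hβx
  simp only [sub_apply, smul_apply, smul_eq_mul] at h3 h4
  simp only [ContinuousLinearMap.comp_apply, smul_apply, neg_apply, add_apply, smul_eq_mul]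
  linarith

end SkewCriticalProblem

/-! ### The local equation of the skew critical points -/

namespace SkewCriticalProblem

variable (P : SkewCriticalProblem k 𝔻 𝔽 E F M N)

/-- The left-hand side of the equation of the skew critical points in the charts at `m₀` and `n₀`,
with respect to a local frame `s` of the distribution: its components are the one-form along the
frame, and the constraint. -/
noncomputable def localEquation (s : M → 𝔻 →L[ℝ] E) (m₀ : M) (n₀ : N) (y : E) : (𝔻 →L[ℝ] ℝ) × F :=
  ((P.coordForm m₀ ((chartAt E m₀).symm y)).comp (s ((chartAt E m₀).symm y)),
    chartAt F n₀ (P.constraint ((chartAt E m₀).symm y)))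

/-- A nondegenerate skew critical point is a regular point of its local equation: the derivative
of the second component is onto, and the skew Hessian is the derivative of the first component on
the kernel of the second one. -/
theorem exists_hasStrictFDerivAt_localEquation [CompleteSpace E] [CompleteSpace F] (hk : 1 ≤ k)
    {m₀ : M} {n₀ : N} (hnd : P.IsNondegenerate m₀ n₀) {s : M → 𝔻 →L[ℝ] E} {U : Set M}
    (hU : U ∈ 𝓝 m₀) (hs : ContMDiffAt 𝓘(ℝ, E) 𝓘(ℝ, 𝔻 →L[ℝ] E) k s m₀)
    (hsD : ∀ m ∈ U, ∀ d, (tangentFrame m₀ m).symm (s m d) ∈ P.dist.fiber m)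
    (e : 𝔻 ≃L[ℝ] P.dist.fiber m₀)
    (he : ∀ d, (e d : TangentSpace 𝓘(ℝ, E) m₀) = (tangentFrame m₀ m₀).symm (s m₀ d)) :
    ∀ᶠ y in 𝓝 (chartAt E m₀ m₀), ∃ Φ' : E ≃L[ℝ] (𝔻 →L[ℝ] ℝ) × F,
      HasStrictFDerivAt (P.localEquation s m₀ n₀) (Φ' : E →L[ℝ] (𝔻 →L[ℝ] ℝ) × F) y := by
  obtain ⟨⟨-, rfl⟩, B, hB⟩ := hnd
  have hk1 : (1 : WithTop ℕ∞) ≤ k := by exact_mod_cast hk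
  set y₀ := chartAt E m₀ m₀
  set A : M → 𝔻 →L[ℝ] ℝ := fun m => (P.coordForm m₀ m).comp (s m)
  have hAm : ContMDiffAt 𝓘(ℝ, E) 𝓘(ℝ, 𝔻 →L[ℝ] ℝ) 1 A m₀ :=
    ((P.contMDiffAt_coordForm m₀).of_le hk1).clm_comp (hs.of_le hk1)
  have hA : ContDiffAt ℝ 1 (fun y => A ((chartAt E m₀).symm y)) y₀ := by
    have := hAm.contDiffAt_chart
    simpa only [chartAt_self_eq, OpenPartialHomeomorph.refl_apply, id_eq] using this
  have hGm : ContMDiffAt 𝓘(ℝ, E) 𝓘(ℝ, F) 1 P.constraint m₀ :=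
    (P.contMDiff_constraint m₀).of_le hk1
  have hG := hGm.contDiffAt_chart
  have hΦ : ContDiffAt ℝ 1 (P.localEquation s m₀ (P.constraint m₀)) y₀ := hA.prodMk hG
  set DA := fderiv ℝ (fun y => A ((chartAt E m₀).symm y)) y₀
  set DG : E →L[ℝ] F := fderiv ℝ (fun y => chartAt F (P.constraint m₀)
    (P.constraint ((chartAt E m₀).symm y))) y₀
  have hDGeq : mfderiv 𝓘(ℝ, E) 𝓘(ℝ, F) P.constraint m₀ = DG :=
    (hGm.mdifferentiableAt one_ne_zero).mfderiv_eq_fderiv_chart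
  have hder : HasFDerivAt (P.localEquation s m₀ (P.constraint m₀)) (DA.prod DG) y₀ :=
    (hA.differentiableAt one_ne_zero).hasFDerivAt.prodMk
      (hG.differentiableAt one_ne_zero).hasFDerivAt
  -- the skew Hessian is evaluated on the local section `x ↦ s x d`
  have hBA : ∀ (u : P.kerConstraint m₀) (d : 𝔻), B u (e d) = DA u.1 d := by
    intro u d
    have hsec : P.IsLocalSection m₀ (e d) fun x => (tangentFrame m₀ x).symm (s x d) := by
      refine ⟨?_, mem_of_superset hU fun x hx => hsD x hx d, (he d).symm⟩
      rw [contMDiffAt_section]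
      refine ((hs.of_le hk1).clm_apply (contMDiffAt_const (c := d))).congr_of_eventuallyEq ?_
      filter_upwards [(chartAt E m₀).open_source.mem_nhds (mem_chart_source E m₀)] with x hx
      rw [trivializationAt_tangent_snd hx]
      simp
    have h1 := hB u (e d) _ hsec
    have h2 : ContMDiffAt 𝓘(ℝ, E) 𝓘(ℝ, ℝ) 1 (fun x => A x d) m₀ :=
      hAm.clm_apply contMDiffAt_const
    have h3 : mfderiv 𝓘(ℝ, E) 𝓘(ℝ, ℝ) (fun x => A x d) m₀ =
        fderiv ℝ (fun y => A ((chartAt E m₀).symm y) d) y₀ := by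
      rw [(h2.mdifferentiableAt one_ne_zero).mfderiv_eq_fderiv_chart]
      simp only [chartAt_self_eq, OpenPartialHomeomorph.refl_apply]
      rfl
    have h4 : fderiv ℝ (fun y => A ((chartAt E m₀).symm y) d) y₀ = DA.flip d := by
      refine HasFDerivAt.fderiv ?_
      have := ((hA.differentiableAt one_ne_zero).hasFDerivAt).clm_apply (hasFDerivAt_const d y₀)
      simpa using this
    refine h1.trans ?_
    change mfderiv 𝓘(ℝ, E) 𝓘(ℝ, ℝ) (fun x => A x d) m₀ u = _
    rw [h3, h4]
    rfl
  have hsurj : Function.Surjective DG := by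
    have := P.surjective_mfderiv m₀
    rwa [hDGeq] at this
  have hker : ∀ u : E, DG u = 0 → (u : TangentSpace 𝓘(ℝ, E) m₀) ∈ P.kerConstraint m₀ := by
    intro u hu
    rw [kerConstraint, hDGeq]
    exact hu
  -- injectivity and surjectivity of `(DA, DG)` reduce to those of `B` by means of `e`
  have hinj' : (DA.prod DG).ker = ⊥ := by
    rw [LinearMap.ker_eq_bot']
    intro u hu
    have hu1 : DA u = 0 := congrArg Prod.fst hu
    have hu2 : DG u = 0 := congrArg Prod.snd hu
    have : B ⟨u, hker u hu2⟩ = 0 := by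
      ext v
      obtain ⟨d, rfl⟩ := e.surjective v
      rw [hBA]
      simp [hu1]
    have h5 := (map_eq_zero_iff B B.injective).1 this
    exact congrArg Subtype.val h5
  have hsurj' : (DA.prod DG).range = ⊤ := by
    rw [LinearMap.range_eq_top]
    rintro ⟨l, f⟩
    obtain ⟨u₀, hu₀⟩ := hsurj f
    obtain ⟨u₁, hu₁⟩ := B.surjective ((l - DA u₀).comp (e.symm : P.dist.fiber m₀ →L[ℝ] 𝔻))
    obtain ⟨w, hw⟩ : ∃ w : E, w = u₁.1 := ⟨_, rfl⟩
    have h6 : DA w = l - DA u₀ := by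
      ext d
      rw [hw, ← hBA, hu₁]
      simp
    have h7 : DG w = 0 := by
      have : mfderiv 𝓘(ℝ, E) 𝓘(ℝ, F) P.constraint m₀ u₁.1 = 0 := u₁.2
      rw [hDGeq, ← hw] at this
      exact this
    refine ⟨u₀ + w, Prod.ext ?_ ?_⟩
    · change DA (u₀ + w) = l
      rw [map_add, h6]
      abel
    · change DG (u₀ + w) = f
      rw [map_add, h7, hu₀, add_zero]
  have hder' : fderiv ℝ (P.localEquation s m₀ (P.constraint m₀)) y₀ =
      (ContinuousLinearEquiv.ofBijective (DA.prod DG) hinj' hsurj' :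
        E →L[ℝ] (𝔻 →L[ℝ] ℝ) × F) := by
    rw [hder.fderiv]
    rfl
  have hnhds := ContinuousLinearEquiv.nhds (ContinuousLinearEquiv.ofBijective _ hinj' hsurj')
  rw [← hder'] at hnhds
  have hcont : ContinuousAt (fderiv ℝ (P.localEquation s m₀ (P.constraint m₀))) y₀ :=
    (hΦ.fderiv_right (m := 0) (by simp)).continuousAt
  filter_upwards [hcont.preimage_mem_nhds hnhds, hΦ.eventually (by simp)] with y ⟨Φ', hΦ'⟩ hy
  exact ⟨Φ', hΦ' ▸ hy.hasStrictFDerivAt one_ne_zero⟩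

end SkewCriticalProblem

/-! ### Order of contact of the solutions -/

namespace SkewCriticalProblem

theorem IsSkewCriticalPoint.of_eq {P₁ P₂ : SkewCriticalProblem k 𝔻 𝔽 E F M N} {m : M} {n : N}
    (hc : P₁.IsSkewCriticalPoint m n) (hα : P₁.oneFormMap m = P₂.oneFormMap m)
    (hg : P₁.constraint m = P₂.constraint m)
    (hD : P₁.dist.toGrassmann m = P₂.dist.toGrassmann m) : P₂.IsSkewCriticalPoint m n := by
  have h1 : P₁.oneForm m = P₂.oneForm m := by
    simpa [oneFormMap] using hα
  have h2 : P₁.dist.fiber m = P₂.dist.fiber m := by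
    simpa [TangentDistribution.toGrassmann] using hD
  exact ⟨fun v hv => h1 ▸ hc.1 v (h2 ▸ hv), hg ▸ hc.2⟩

/-- If a common value `m` of two families of skew critical points is a regular point of the local
equation of the first problem, then the families have contact of order `r` there: the values of
the local equation along the families do, and the local inverse carries this over to the
families. -/
theorem orderEqAt_of_localEquation [CompleteSpace 𝔻] [CompleteSpace E]
    [IsManifold 𝓘(ℝ, F) 1 N] {r : ℕ} {hM : M → ℝ} {hN : N → ℝ}
    {P₁ P₂ : SkewCriticalProblem k 𝔻 𝔽 E F M N} {γ₁ γ₂ : N → M} {m₀ : M} {n₀ n : N}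
    (hγ : γ₁ n = γ₂ n) (hγ₁ : ContinuousAt γ₁ n) (hγ₂ : ContinuousAt γ₂ n)
    (hc₁ : ∀ᶠ x in 𝓝 n, P₁.IsSkewCriticalPoint (γ₁ x) x)
    (hc₂ : ∀ᶠ x in 𝓝 n, P₂.IsSkewCriticalPoint (γ₂ x) x)
    (hα : OrderEqAt (𝓘(ℝ, E).prod 𝓘(ℝ, E →L[ℝ] ℝ)) hM r P₁.oneFormMap P₂.oneFormMap (γ₁ n))
    (hg : OrderEqAt 𝓘(ℝ, F) hM r P₁.constraint P₂.constraint (γ₁ n))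
    (hD : OrderEqAt 𝓘(ℝ, E × (𝔻 →L[ℝ] 𝔽)) hM r P₁.dist.toGrassmann P₂.dist.toGrassmann (γ₁ n))
    (hα₀ : P₁.oneFormMap (γ₁ n) = P₂.oneFormMap (γ₁ n))
    (hg₀ : P₁.constraint (γ₁ n) = P₂.constraint (γ₁ n))
    {q : N → ℝ} (hq : ContinuousAt q n) (hqe : ∀ᶠ x in 𝓝 n, hM (γ₂ x) = hN x * q x)
    (hm : γ₁ n ∈ (chartAt E m₀).source) (hn : n ∈ (chartAt F n₀).source)
    {s : M → 𝔻 →L[ℝ] E} (hs : ContinuousAt s (γ₁ n))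
    (hsD : ∀ᶠ x in 𝓝 (γ₁ n), ∀ d, (tangentFrame m₀ x).symm (s x d) ∈ P₁.dist.fiber x)
    {Φ' : E ≃L[ℝ] (𝔻 →L[ℝ] ℝ) × F} (hΦ : HasStrictFDerivAt (P₁.localEquation s m₀ n₀)
      (Φ' : E →L[ℝ] (𝔻 →L[ℝ] ℝ) × F) (chartAt E m₀ (γ₁ n))) :
    OrderEqAt 𝓘(ℝ, E) hN r γ₁ γ₂ n := by
  set φ := chartAt E m₀
  set Φ := P₁.localEquation s m₀ n₀
  obtain ⟨ε, hε, hεe⟩ := exists_coordForm_comp_frame_eq hm hα hα₀ hD hs hsD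
  have hcn : P₁.constraint (γ₁ n) = n := hc₁.self_of_nhds.2
  obtain ⟨ζ, hζ, hζe⟩ := hg.exists_of_mem_atlas P₁.contMDiff_constraint.continuous.continuousAt
    P₂.contMDiff_constraint.continuous.continuousAt hg₀ (chart_mem_atlas F n₀)
    (by rw [hcn]; exact hn)
  rw [hγ] at hε hζ hεe hζe
  have hs₁ : ∀ᶠ x in 𝓝 n, γ₁ x ∈ φ.source := hγ₁.preimage_mem_nhds (φ.open_source.mem_nhds hm)
  have hs₂ : ∀ᶠ x in 𝓝 n, γ₂ x ∈ φ.source :=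
    hγ₂.preimage_mem_nhds (φ.open_source.mem_nhds (hγ ▸ hm))
  have hX₁ : Tendsto (fun x => φ (γ₁ x)) (𝓝 n) (𝓝 (φ (γ₁ n))) :=
    ContinuousAt.comp (φ.continuousAt hm) hγ₁
  have hX₂ : Tendsto (fun x => φ (γ₂ x)) (𝓝 n) (𝓝 (φ (γ₁ n))) := by
    rw [hγ]
    exact ContinuousAt.comp (φ.continuousAt (hγ ▸ hm)) hγ₂
  have hdiff : ∀ᶠ x in 𝓝 n, Φ (φ (γ₂ x)) - Φ (φ (γ₁ x)) =
      hN x ^ r • (q x ^ r • (ε (γ₂ x), -ζ (γ₂ x))) := by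
    filter_upwards [hs₁, hs₂, hc₁, hc₂, hqe, hγ₂.eventually hεe, hγ₂.eventually hζe,
      hγ₁.eventually hsD] with x h₁ h₂ hx₁ hx₂ hqx hεx hζx hsx
    have hA : (P₁.coordForm m₀ (γ₁ x)).comp (s (γ₁ x)) = 0 :=
      ContinuousLinearMap.ext fun d => hx₁.1 _ (hsx d)
    have hG := hζx.2.2
    rw [hx₂.2] at hG
    simp only [OpenPartialHomeomorph.extend_coe, modelWithCornersSelf_coe, Function.comp_apply,
      id_eq] at hG
    have e₁ : Φ (φ (γ₁ x)) = (0, chartAt F n₀ x) := by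
      simp only [Φ, localEquation]
      rw [φ.left_inv h₁, hA, hx₁.2]
    have e₂ : Φ (φ (γ₂ x)) =
        (hM (γ₂ x) ^ r • ε (γ₂ x), chartAt F n₀ (P₁.constraint (γ₂ x))) := by
      simp only [Φ, localEquation]
      rw [φ.left_inv h₂, hεx hx₂.1]
    rw [e₁, e₂, smul_smul, ← mul_pow, ← hqx]
    refine Prod.ext (by simp) ?_
    simp [← hG]
  have hΦc := hΦ.continuousAt
  obtain ⟨δ, hδ, hδe⟩ := hΦ.to_localInverse.exists_smul_eq_sub_comp (hΦc.tendsto.comp hX₁)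
    (hΦc.tendsto.comp hX₂) (e := fun x => q x ^ r • (ε (γ₂ x), -ζ (γ₂ x)))
    ((hq.pow r).smul ((ContinuousAt.comp hε hγ₂).prodMk (ContinuousAt.comp hζ hγ₂).neg)) hdiff
  refine ⟨φ, chart_mem_atlas E m₀, hm, δ, hδ, ?_⟩
  have hinv := hΦ.eventually_left_inverse
  filter_upwards [hs₁, hs₂, hδe, hX₁.eventually hinv, hX₂.eventually hinv] with x h₁ h₂ hx i₁ i₂
  refine ⟨h₁, h₂, ?_⟩
  simp only [Function.comp_apply] at hx
  rw [i₁, i₂] at hx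
  simpa using hx

end SkewCriticalProblem

end LocalTheory

theorem mainTheorem1 {𝔻 𝔽 E F M N : Type*}
    [NormedAddCommGroup 𝔻] [NormedSpace ℝ 𝔻] [CompleteSpace 𝔻]
    [NormedAddCommGroup 𝔽] [NormedSpace ℝ 𝔽] [CompleteSpace 𝔽]
    [NormedAddCommGroup E] [NormedSpace ℝ E] [CompleteSpace E]
    [NormedAddCommGroup F] [NormedSpace ℝ F] [CompleteSpace F]
    [TopologicalSpace M] [ChartedSpace E M] [IsManifold 𝓘(ℝ, E) ∞ M]
    [TopologicalSpace N] [ChartedSpace F N] [IsManifold 𝓘(ℝ, F) ∞ N] [ParacompactSpace N]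
    (k : ℕ∞) (hk : 1 ≤ k) (r : ℕ) (hr : 1 ≤ r)
    (hM : M → ℝ) (hN : N → ℝ)
    (hM_order : IsOrderFunction (E := E) hM) (hN_order : IsOrderFunction (E := F) hN)
    (P₁ P₂ : SkewCriticalProblem k 𝔻 𝔽 E F M N)
    (M₀ U₁ U₂ : Set M) (N₀ V₁ V₂ : Set N) (γ₁ γ₂ : N → M)
    (hγ₁ : P₁.IsSemiglobalSolution M₀ U₁ N₀ V₁ γ₁)
    (hγ₂ : P₂.IsSemiglobalSolution M₀ U₂ N₀ V₂ γ₂)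
    (hM₀ : ∀ m ∈ M₀, hM m = 0) (hN₀ : ∀ n ∈ N₀, hN n = 0)
    (hzero : ∀ n₀ ∈ N₀, ∀ᶠ n in 𝓝 n₀, hN n = 0 → hM (γ₁ n) = 0)
    (hα : OrderEqOn (𝓘(ℝ, E).prod 𝓘(ℝ, E →L[ℝ] ℝ)) hM r P₁.oneFormMap P₂.oneFormMap univ)
    (hg : OrderEqOn 𝓘(ℝ, F) hM r P₁.constraint P₂.constraint univ)
    (hD : OrderEqOn 𝓘(ℝ, E × (𝔻 →L[ℝ] 𝔽)) hM r
      P₁.dist.toGrassmann P₂.dist.toGrassmann univ) :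
    ∃ W : Set N, IsOpen W ∧ N₀ ⊆ W ∧ W ⊆ V₁ ∩ V₂ ∧ OrderEqOn 𝓘(ℝ, E) hN r γ₁ γ₂ W := by
  have hk1 : (1 : WithTop ℕ∞) ≤ k := by exact_mod_cast hk
  suffices hloc : ∀ n₀ ∈ N₀, ∀ᶠ n in 𝓝 n₀, n ∈ V₁ ∩ V₂ ∧
      (hN n = 0 → γ₁ n = γ₂ n ∧ OrderEqAt 𝓘(ℝ, E) hN r γ₁ γ₂ n) by
    refine ⟨interior {n | n ∈ V₁ ∩ V₂ ∧
      (hN n = 0 → γ₁ n = γ₂ n ∧ OrderEqAt 𝓘(ℝ, E) hN r γ₁ γ₂ n)}, isOpen_interior,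
      fun n₀ hn₀ => mem_interior_iff_mem_nhds.2 (hloc n₀ hn₀),
      fun n hn => (interior_subset hn).1, fun n hn h => ((interior_subset hn).2 h).1,
      fun n hn h => ((interior_subset hn).2 h).2⟩
  intro n₀ hn₀
  have hcont : ∀ n ∈ V₁, ContinuousAt γ₁ n := fun n hn =>
    (hγ₁.contMDiffOn.continuousOn).continuousAt (hγ₁.isOpen_V.mem_nhds hn)
  have hm₀ : γ₁ n₀ ∈ M₀ := hγ₁.restrictsToDiffeo.2.1 hn₀
  have hc₀ := hcont n₀ (hγ₁.N₀_subset hn₀)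
  obtain ⟨U, s, hU, hm₀U, hs, hsD, e, he⟩ := P₁.dist.exists_local_frame (γ₁ n₀)
  have hV : ∀ᶠ n in 𝓝 n₀, n ∈ V₁ ∩ V₂ := inter_mem
    (hγ₁.isOpen_V.mem_nhds (hγ₁.N₀_subset hn₀)) (hγ₂.isOpen_V.mem_nhds (hγ₂.N₀_subset hn₀))
  -- over the zeros of `hN`, the first solution is also critical for the second problem
  have hagree : ∀ᶠ n in 𝓝 n₀, hN n = 0 → hM (γ₁ n) = 0 ∧ γ₁ n = γ₂ n := by
    filter_upwards [hV, hzero n₀ hn₀,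
      hc₀.preimage_mem_nhds (hγ₂.isOpen_U.mem_nhds (hγ₂.M₀_subset hm₀))] with n hn hz hnU h
    refine ⟨hz h, hγ₂.unique n hn.2 _ hnU ?_⟩
    exact (hγ₁.critical n hn.1).of_eq (hα.1 _ trivial (hz h)) (hg.1 _ trivial (hz h))
      (hD.1 _ trivial (hz h))
  have hreg := (((chartAt E (γ₁ n₀)).continuousAt (mem_chart_source E (γ₁ n₀))).tendsto.comp
    hc₀).eventually (P₁.exists_hasStrictFDerivAt_localEquation hk (hγ₁.nondegenerate n₀ hn₀)
      (hU.mem_nhds hm₀U) (hs.contMDiffAt (hU.mem_nhds hm₀U)) hsD e he)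
  filter_upwards [hV, hagree, eventually_eventually_nhds.2 hagree, hreg,
    hc₀.preimage_mem_nhds (hU.mem_nhds hm₀U),
    hc₀.preimage_mem_nhds ((chartAt E (γ₁ n₀)).open_source.mem_nhds (mem_chart_source E (γ₁ n₀))),
    (chartAt F n₀).open_source.mem_nhds (mem_chart_source F n₀)] with
    n hn hagn hagn' ⟨Φ', hΦ'⟩ hnU hnφ hnn₀
  refine ⟨hn, fun h => ⟨(hagn h).2, ?_⟩⟩
  have hMn := (hagn h).1
  have hV₁ := hγ₁.isOpen_V.mem_nhds hn.1
  have hV₂ := hγ₂.isOpen_V.mem_nhds hn.2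
  have hγ₂d := hγ₂.contMDiffOn.contMDiffAt hV₂
  obtain ⟨q, hq, hqe⟩ := ContMDiffAt.exists_eq_mul_of_zero (f := hM ∘ γ₂) (h := hN) (p := n)
    ((hM_order.contMDiff.contMDiffAt.of_le (by simp)).comp n (hγ₂d.of_le hk1))
    (hN_order.contMDiff.contMDiffAt.of_le (by simp)) (hN_order.regular n h) h
    (hagn'.mono fun x hx hx0 => by
      rw [Function.comp_apply, ← (hx hx0).2, (hx hx0).1])
  exact SkewCriticalProblem.orderEqAt_of_localEquation (hagn h).2 (hcont n hn.1)
    hγ₂d.continuousAt (mem_of_superset hV₁ fun x hx => hγ₁.critical x hx)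
    (mem_of_superset hV₂ fun x hx => hγ₂.critical x hx) (hα.2 _ trivial hMn)
    (hg.2 _ trivial hMn) (hD.2 _ trivial hMn) (hα.1 _ trivial hMn) (hg.1 _ trivial hMn) hq hqe
    hnφ hnn₀ (hs.continuousOn.continuousAt (hU.mem_nhds hnU))
    (mem_of_superset (hU.mem_nhds hnU) hsD) hΦ'
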